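/- Let $T$ be a complete theory in a language $\mathcal L$, and let $\mathbb M\models T$ be a monster model: $\mathbb M$ is $\bar\kappa$-saturated and strongly $\bar\kappa$-homogeneous for some $\bar\kappa>|\mathcal L|+\aleph_0$. A set, a model $M\prec\mathbb M$ or a tuple is small if its size (length) is $<\bar\kappa$; sets, models and tuples are taken in $\mathbb M$. A formula $\varphi(x;b)$ divides over a small set $A$ if for some $k$ and some $A$-indiscernible sequence $\langle b_i: i<\omega\rangle$ of realizations of $\mathrm{tp}(b/A)$, any $k$ of the formulas $\varphi(x;b_i)$ (with distinct indices) are jointly inconsistent; it forks over $A$ if it implies a finite disjunction of formulas that divide over $A$; a type forks over $A$ if it implies a formula that forks over $A$. Write $a\perp_A C$ if $\mathrm{tp}(a/AC)$ does not fork over $A$. Assume the existence axiom: for every small set $A$, no complete type over $A$ (in finitely many variables) forks over $A$. For a model $M$ write $c\perp^u_M B$ if $\mathrm{tp}(c/MB)$ is finitely satisfiable in $M$; $\mathrm{tp}(a/Mc)$ is an heir of $\mathrm{tp}(a/M)$ if $c\perp^u_M a$. A sequence $\langle a_i:i<\omega\rangle$ is $A$-Morley if it is an $A$-indiscernible sequence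 of realizations of some $p\in S(A)$ and $a_i\perp_A a_{<i}$ for all $i$. It is a coheir sequence over $M$ if there is an $M$-invariant global type $q\in S(\mathbb M)$, finitely satisfiable in $M$, with $a_i\models q|_{Ma_{<i}}$ for all $i$. Let $A$ be a small set and let $I=\langle a_i: i<\omega\rangle$ be an $A$-Morley sequence of small tuples. Then: (1) There is a small model $M\supseteq A$ such that $M\perp_A I$, $I$ is $M$-indiscernible, $\mathrm{tp}(a_{<k}/Ma_{\ge k})$ is an heir of $\mathrm{tp}(a_{<k}/M)$ for every $k<\omega$, and $I$ is a coheir sequence over $M$. (2) If $M_0\supseteq A$ is a small model such that $M_0\perp_A I$ and $I$ is $M_0$-indiscernible, then there is a small model $M\succ M_0$ such that $M\perp_A I$ and $I$ is a coheir sequence over $M$. -/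

import Mathlib

open scoped Cardinal

universe u v w x y

namespace MonsterModel

open FirstOrder FirstOrder.Language

section Types

variable (L : FirstOrder.Language.{u, v}) {𝕄 : Type w} [L.Structure 𝕄] {ι : Type x} {β : Type y}

/-- The space `S_ι(B)` of complete types over `B` in the variables `ι`, i.e. complete types of the
theory of `𝕄` with the elements of `B` named. -/
abbrev TypesOver (B : Set 𝕄) (ι : Type x) :=
  (L[[B]].completeTheory 𝕄).CompleteType ι

/-- The complete type `tp(a / B)`. -/
def tp [Nonempty 𝕄] (B : Set 𝕄) (a : ι → 𝕄) : TypesOver L B ι :=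
  (L[[B]].completeTheory 𝕄).typeOf a

/-- `a` realizes the type `p` over `B`. -/
def Realizes [Nonempty 𝕄] {B : Set 𝕄} (a : ι → 𝕄) (p : TypesOver L B ι) : Prop :=
  tp L B a = p

variable {L}

/-- The formula `θ`, with parameters in `B`, belongs to the type `p` over `B`. -/
def Contains {B : Set 𝕄} (p : TypesOver L B ι) (θ : L[[B]].Formula ι) : Prop :=
  Formula.equivSentence θ ∈ p

/-- The formula `φ(x; b)` with parameters `b` from `B` that is obtained from an `L`-formula
`φ(x; y)`. -/
def inst (B : Set 𝕄) (φ : L.Formula (ι ⊕ β)) (b : β → B) : L[[B]].Formula ι :=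
  BoundedFormula.constantsVarsEquiv.symm
    (Formula.relabel (Sum.elim Sum.inr (fun j => Sum.inl (b j))) φ)

theorem realize_inst (B : Set 𝕄) (φ : L.Formula (ι ⊕ β)) (b : β → B) (a : ι → 𝕄) :
    (inst B φ b).Realize a ↔ φ.Realize (Sum.elim a (fun j => (b j : 𝕄))) := by
  unfold inst Formula.Realize
  rw [← BoundedFormula.realize_constantsVarsEquiv, Equiv.apply_symm_apply]
  have h := Formula.realize_relabel (φ := φ)
    (g := (Sum.elim Sum.inr (fun j => Sum.inl (b j)) : ι ⊕ β → B ⊕ ι))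
    (v := Sum.elim (fun c : B => (L.con c : 𝕄)) a)
  unfold Formula.Realize at h
  have e : (Sum.elim (fun c : B => (L.con c : 𝕄)) a) ∘
      (Sum.elim Sum.inr (fun j => Sum.inl (b j)) : ι ⊕ β → B ⊕ ι) =
      Sum.elim a (fun j => (b j : 𝕄)) := by
    funext z
    rcases z with z | z <;> simp
  rw [e] at h
  exact h

theorem contains_tp [Nonempty 𝕄] (B : Set 𝕄) (a : ι → 𝕄) (θ : L[[B]].Formula ι) :
    Contains (tp L B a) θ ↔ θ.Realize a :=
  Theory.CompleteType.formula_mem_typeOf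

end Types

section Monster

/-- `𝕄` is `κ`-saturated: every complete type in finitely many variables over fewer than `κ`
parameters is realized. -/
def IsSaturated (L : FirstOrder.Language.{u, v}) (𝕄 : Type w) [L.Structure 𝕄] [Nonempty 𝕄]
    (κ : Cardinal.{w}) : Prop :=
  ∀ (B : Set 𝕄), #B < κ → ∀ (n : ℕ) (p : TypesOver L B (Fin n)), ∃ a : Fin n → 𝕄, Realizes L a p

/-- `𝕄` is (strongly) `κ`-homogeneous: two tuples of the same length less than `κ` that have the
same type are conjugate by an automorphism. -/
def IsHomogeneous (L : FirstOrder.Language.{u, v}) (𝕄 : Type w) [L.Structure 𝕄] (κ : Cardinal.{w}) : Prop :=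
  ∀ (α : Type w), #α < κ → ∀ a b : α → 𝕄,
    (∀ φ : L.Formula α, φ.Realize a ↔ φ.Realize b) → ∃ σ : 𝕄 ≃[L] 𝕄, ∀ i, σ (a i) = b i

/-- `𝕄` is a monster model of `T`, where `κ` is larger than `|L| + ℵ₀`. -/
structure IsMonster {L : FirstOrder.Language.{u, v}} (T : L.Theory) (𝕄 : Type w) [L.Structure 𝕄]
    [Nonempty 𝕄] (κ : Cardinal.{w}) : Prop where
  models : 𝕄 ⊨ T
  aleph0_lt : ℵ₀ < κ
  card_language_lt : Cardinal.lift.{w} L.card < Cardinal.lift.{max u v} κ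
  saturated : IsSaturated L 𝕄 κ
  homogeneous : IsHomogeneous L 𝕄 κ

end Monster

section Forking

variable {L : FirstOrder.Language.{u, v}} {𝕄 : Type w} [L.Structure 𝕄] [Nonempty 𝕄] {ι : Type x}

variable (L) in
/-- The sequence `⟨a_i : i < ω⟩` of `ι`-tuples is indiscernible over `A`. -/
def Indiscernible (A : Set 𝕄) (a : ℕ → ι → 𝕄) : Prop :=
  ∀ (n : ℕ) (i j : Fin n → ℕ), StrictMono i → StrictMono j →
    tp L A (fun z : Fin n × ι => a (i z.1) z.2) = tp L A (fun z : Fin n × ι => a (j z.1) z.2)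

/-- The formula `φ(x; b)` `k`-divides over `A`. -/
def KDivides (k : ℕ) (A : Set 𝕄) {m : ℕ} (φ : L.Formula (ι ⊕ Fin m)) (b : Fin m → 𝕄) : Prop :=
  ∃ c : ℕ → Fin m → 𝕄, Indiscernible L A c ∧ (∀ i, Realizes L (c i) (tp L A b)) ∧
    ∀ s : Finset ℕ, s.card = k → ¬ ∃ a : ι → 𝕄, ∀ i ∈ s, φ.Realize (Sum.elim a (c i))

/-- The formula `φ(x; b)` divides over `A`. -/
def Divides (A : Set 𝕄) {m : ℕ} (φ : L.Formula (ι ⊕ Fin m)) (b : Fin m → 𝕄) : Prop :=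
  ∃ k : ℕ, KDivides k A φ b

/-- The formula `φ(x; b)` forks over `A`: it implies a finite disjunction of formulas
`ψ_i(x; c_i)` that divide over `A`. -/
def Forks (A : Set 𝕄) {m : ℕ} (φ : L.Formula (ι ⊕ Fin m)) (b : Fin m → 𝕄) : Prop :=
  ∃ (n : ℕ) (l : Fin n → ℕ) (ψ : ∀ i, L.Formula (ι ⊕ Fin (l i))) (c : ∀ i, Fin (l i) → 𝕄),
    (∀ a : ι → 𝕄, φ.Realize (Sum.elim a b) → ∃ i, (ψ i).Realize (Sum.elim a (c i))) ∧
    ∀ i, Divides A (ψ i) (c i)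

/-- The complete type `p` over `B` implies the formula `φ(x; b)`; as `p` is closed under
conjunctions, this means that a formula of `p` does. -/
def Implies {B : Set 𝕄} (p : TypesOver L B ι) {m : ℕ} (φ : L.Formula (ι ⊕ Fin m))
    (b : Fin m → 𝕄) : Prop :=
  ∃ θ : L[[B]].Formula ι, Contains p θ ∧ ∀ a : ι → 𝕄, θ.Realize a → φ.Realize (Sum.elim a b)

/-- The type `p` over `B` forks over `A`. -/
def TypeForks (A : Set 𝕄) {B : Set 𝕄} (p : TypesOver L B ι) : Prop :=
  ∃ (m : ℕ) (φ : L.Formula (ι ⊕ Fin m)) (b : Fin m → 𝕄), Implies p φ b ∧ Forks A φ b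

variable (L) in
/-- Nonforking independence `a ⫝_A C`: the type `tp(a / AC)` does not fork over `A`. -/
def Indep (A : Set 𝕄) (a : ι → 𝕄) (C : Set 𝕄) : Prop :=
  ¬ TypeForks A (tp L (A ∪ C) a)

variable (L 𝕄) in
/-- The existence axiom: no complete type over a small set forks over that set. -/
def ExistenceAxiom (κ : Cardinal.{w}) : Prop :=
  ∀ A : Set 𝕄, #A < κ → ∀ (n : ℕ) (p : TypesOver L A (Fin n)), ¬ TypeForks A p

/-- The set of all coordinates of the tuples `a_i` with `i ∈ s`. -/
def entries (a : ℕ → ι → 𝕄) (s : Set ℕ) : Set 𝕄 :=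
  ⋃ i ∈ s, Set.range (a i)

/-- `⟨a_i : i < ω⟩` is a Morley sequence in `p ∈ S(A)`. -/
def IsMorleyIn {A : Set 𝕄} (p : TypesOver L A ι) (a : ℕ → ι → 𝕄) : Prop :=
  Indiscernible L A a ∧ (∀ i, Realizes L (a i) p) ∧ ∀ i, Indep L A (a i) (entries a (Set.Iio i))

variable (L) in
/-- `⟨a_i : i < ω⟩` is an `A`-Morley sequence. -/
def IsMorley (A : Set 𝕄) (a : ℕ → ι → 𝕄) : Prop :=
  ∃ p : TypesOver L A ι, IsMorleyIn p a

end Forking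

section Coheirs

variable {L : FirstOrder.Language.{u, v}} {𝕄 : Type w} [L.Structure 𝕄] [Nonempty 𝕄] {ι : Type x}

/-- The type `p` over `B` is finitely satisfiable in the set `M`. -/
def FinSat {B : Set 𝕄} (M : Set 𝕄) (p : TypesOver L B ι) : Prop :=
  ∀ θ : L[[B]].Formula ι, Contains p θ → ∃ d : ι → 𝕄, (∀ i, d i ∈ M) ∧ θ.Realize d

variable (L) in
/-- `a ⫝ᵘ_M C`: the type `tp(a / MC)` is finitely satisfiable in `M`. -/
def CoheirIndep (M : Set 𝕄) (a : ι → 𝕄) (C : Set 𝕄) : Prop :=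
  FinSat M (tp L (M ∪ C) a)

variable (L) in
/-- The type `tp(a / MC)`, for `C` the set of coordinates of the tuple `c`, is an heir of its
restriction to `M`: `c ⫝ᵘ_M a`. -/
def IsHeirOver {γ : Type y} (M : Set 𝕄) (a : ι → 𝕄) (c : γ → 𝕄) : Prop :=
  CoheirIndep L M c (Set.range a)

variable (L 𝕄) in
/-- Global types: complete types over the whole of `𝕄`. -/
abbrev GlobalType (ι : Type x) := TypesOver L (Set.univ : Set 𝕄) ι

/-- The formula `φ(x; b)` belongs to the global type `q`. -/
def GlobalContains (q : GlobalType L 𝕄 ι) {m : ℕ} (φ : L.Formula (ι ⊕ Fin m))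
    (b : Fin m → 𝕄) : Prop :=
  Contains q (inst Set.univ φ (fun j => ⟨b j, Set.mem_univ _⟩))

/-- The global type `q` is `A`-invariant. -/
def IsInvariant (A : Set 𝕄) (q : GlobalType L 𝕄 ι) : Prop :=
  ∀ (m : ℕ) (φ : L.Formula (ι ⊕ Fin m)) (b b' : Fin m → 𝕄), tp L A b = tp L A b' →
    (GlobalContains q φ b ↔ GlobalContains q φ b')

/-- `a` realizes the restriction `q|_B` of the global type `q`. -/
def RealizesRestriction (q : GlobalType L 𝕄 ι) (B : Set 𝕄) (a : ι → 𝕄) : Prop :=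
  ∀ (m : ℕ) (φ : L.Formula (ι ⊕ Fin m)) (b : Fin m → 𝕄), (∀ j, b j ∈ B) →
    GlobalContains q φ b → φ.Realize (Sum.elim a b)

variable (L) in
/-- `⟨a_i : i < ω⟩` is a coheir sequence over `M`: a Morley sequence over `M` in a global
`M`-invariant type that is finitely satisfiable in `M`. -/
def IsCoheirSequence (M : Set 𝕄) (a : ℕ → ι → 𝕄) : Prop :=
  ∃ q : GlobalType L 𝕄 ι, IsInvariant M q ∧ FinSat M q ∧
    ∀ i, RealizesRestriction q (M ∪ entries a (Set.Iio i)) (a i)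

end Coheirs

end MonsterModel

/-!
Extend the sequence `I = ⟨a_i : i < ω⟩` by a copy `J` of its tails, so that `I ⌢ J` is
indiscernible. The type of `a_i` over `a_{<i}` and any set of parameters over which `I ⌢ J` is
indiscernible is realized by the first term of `J`. Hence, if `M` is the union of a chain of sets
`B₀ ⊆ B₁ ⊆ …` such that `B_{n+1}` contains such a continuation `J_n` of `I` over `B_n`, then the
global types of the first terms of the `J_n` have a limit along an ultrafilter on `ω`, this limit is
finitely satisfiable in `M`, and `I` is a Morley sequence over `M` in it
(`IsIndepBase.exists_isCoheirSequence`). The heir property is seen in the same way, using all terms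
of `J_n` instead of the first one.

The chain has to consist of sets `B ⊇ A` such that `B ⫝_A I` and `I` is indiscernible over `B`
(`IsIndepBase`), and infinitely many of them have to be models. Two facts make this possible.

* `IsIndepBase.union_continuation`: `J` may be added to `B`. Tails of a Morley sequence are
  independent from the initial segments before them, hence `J ⫝_A I`; moreover `B ⫝_A I ⌢ J`, and
  left transitivity of nonforking yields `BJ ⫝_A I`.
* `IsIndepBase.exists_model`: `B` may be enlarged to a model. By the existence axiom and the
  extension property there is a model `N ⊇ B` with `N ⫝_B I`, hence `N ⫝_A I` by left transitivity.
  Ramsey's theorem yields an `N`-indiscernible sequence each of whose properties over `N` is shared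
  by a subsequence of `I`. It is still independent from `N` over `A`, and it is conjugate to `I`
  over `B`, so that an automorphism over `B` replaces it by `I`.

Part (1) of the theorem starts the chain with `A` itself, part (2) with `M₀`.

Types are handled through ultrafilters on sets of tuples: an ultrafilter has a limit type over each
set of parameters (`limType`), limit types in fewer than `κ` variables over small sets are realized
(`IsMonster.exists_realizes_limType`), and a type does not fork over `A` if and only if it extends
to an ultrafilter below a fixed filter (`indep_iff_exists_ultrafilter`). Compactness arguments
become statements about filters being proper, and conjugacy of tuples with the same type replaces
most syntactic arguments.
-/

set_option linter.unusedSectionVars false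

namespace MonsterModel

open FirstOrder FirstOrder.Language
open Filter Function

/-! ### Formulas, types and automorphisms -/

section Formulas

variable {L : FirstOrder.Language.{u, v}} {𝕄 : Type w} [L.Structure 𝕄] {α β γ : Type*}

/-- A formula `φ(x; y)` involves only finitely many of the parameter variables `y`; the variables
`x` are left as they are. -/
theorem exists_fin_params (φ : L.Formula (α ⊕ γ)) :
    ∃ (m : ℕ) (g : Fin m → γ) (φ' : L.Formula (α ⊕ Fin m)), ∀ (a : α → 𝕄) (c : γ → 𝕄),
      φ.Realize (Sum.elim a c) ↔ φ'.Realize (Sum.elim a (c ∘ g)) := by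
  classical
  let s : Finset γ := φ.freeVarFinset.toRight
  let e := s.equivFin
  let f : φ.freeVarFinset → α ⊕ Fin s.card := fun z => match z with
    | ⟨Sum.inl x, _⟩ => Sum.inl x
    | ⟨Sum.inr y, h⟩ => Sum.inr (e ⟨y, Finset.mem_toRight.2 h⟩)
  refine ⟨s.card, fun i => (e.symm i : γ), φ.restrictFreeVar f, fun a c => ?_⟩
  refine (BoundedFormula.realize_restrictFreeVar _ ?_).symm
  rintro ⟨x | y, h⟩
  · rfl
  · simp [f]

/-- Finitely many formulas in the variables `α` involve only finitely many of these variables. -/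
theorem exists_fin_vars {n : ℕ} {l : Fin n → Type*} (ψ : ∀ i, L.Formula (α ⊕ l i)) :
    ∃ (N : ℕ) (g : Fin N → α) (ψ' : ∀ i, L.Formula (Fin N ⊕ l i)), Function.Injective g ∧
      ∀ i (a : α → 𝕄) (c : l i → 𝕄),
        (ψ i).Realize (Sum.elim a c) ↔ (ψ' i).Realize (Sum.elim (a ∘ g) c) := by
  classical
  let s : Finset α := Finset.univ.biUnion fun i => (ψ i).freeVarFinset.toLeft
  let e := s.equivFin
  let f : ∀ i, (ψ i).freeVarFinset → Fin s.card ⊕ l i := fun i z => match z with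
    | ⟨Sum.inl x, h⟩ => Sum.inl
        (e ⟨x, Finset.mem_biUnion.2 ⟨i, Finset.mem_univ _, Finset.mem_toLeft.2 h⟩⟩)
    | ⟨Sum.inr y, h⟩ => Sum.inr y
  refine ⟨s.card, fun i => (e.symm i : α), fun i => (ψ i).restrictFreeVar (f i),
    fun i j h => e.symm.injective (Subtype.ext h), fun i a c => ?_⟩
  refine (BoundedFormula.realize_restrictFreeVar _ ?_).symm
  rintro ⟨x | y, h⟩
  · simp [f]
  · rfl

variable [Nonempty 𝕄] {B : Set 𝕄} {a a' : α → 𝕄}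

theorem tp_eq_iff_realize :
    tp L B a = tp L B a' ↔ ∀ θ : L[[B]].Formula α, θ.Realize a ↔ θ.Realize a' := by
  constructor
  · intro h θ
    rw [← contains_tp, ← contains_tp, h]
  · intro h
    refine SetLike.ext fun φ => ?_
    obtain ⟨θ, rfl⟩ := Formula.equivSentence.surjective φ
    exact (contains_tp B a θ).trans ((h θ).trans (contains_tp B a' θ).symm)

/-- Every formula with parameters in `B` is of the form `φ(x; b)` with a finite tuple `b`. -/
theorem exists_fin_inst (θ : L[[B]].Formula α) :
    ∃ (m : ℕ) (φ : L.Formula (α ⊕ Fin m)) (b : Fin m → B), ∀ a : α → 𝕄,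
      θ.Realize a ↔ φ.Realize (Sum.elim a (fun j => (b j : 𝕄))) := by
  obtain ⟨m, g, φ, h⟩ := exists_fin_params (𝕄 := 𝕄)
    (Formula.relabel Sum.swap (BoundedFormula.constantsVarsEquiv θ) : L.Formula (α ⊕ B))
  refine ⟨m, φ, g, fun a => ?_⟩
  have h1 := h a Subtype.val
  rw [Formula.realize_relabel] at h1
  refine Iff.trans ?_ h1
  unfold Formula.Realize
  rw [← BoundedFormula.realize_constantsVarsEquiv]
  refine iff_of_eq ?_
  congr 1
  funext z
  rcases z with z | z <;> simp

theorem tp_eq_iff :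
    tp L B a = tp L B a' ↔ ∀ (m : ℕ) (φ : L.Formula (α ⊕ Fin m)) (b : Fin m → 𝕄), (∀ j, b j ∈ B) →
      (φ.Realize (Sum.elim a b) ↔ φ.Realize (Sum.elim a' b)) := by
  rw [tp_eq_iff_realize]
  constructor
  · intro h m φ b hb
    have := h (inst B φ (fun j => ⟨b j, hb j⟩))
    rwa [realize_inst, realize_inst] at this
  · intro h θ
    obtain ⟨m, φ, b, hb⟩ := exists_fin_inst θ
    rw [hb, hb]
    exact h m φ _ fun j => (b j).2

theorem realize_iff_of_tp_eq (h : tp L B a = tp L B a') (φ : L.Formula (α ⊕ γ)) {c : γ → 𝕄}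
    (hc : ∀ j, c j ∈ B) : φ.Realize (Sum.elim a c) ↔ φ.Realize (Sum.elim a' c) := by
  have := (tp_eq_iff_realize.1 h) (inst B φ (fun j => ⟨c j, hc j⟩))
  rwa [realize_inst, realize_inst] at this

/-- Since types are closed under negation, an inclusion of types is an equality. -/
theorem tp_eq_of_imp (h : ∀ φ : L.Formula (α ⊕ B),
    φ.Realize (Sum.elim a Subtype.val) → φ.Realize (Sum.elim a' Subtype.val)) :
    tp L B a = tp L B a' := by
  have h' : ∀ φ : L.Formula (α ⊕ B),
      φ.Realize (Sum.elim a Subtype.val) ↔ φ.Realize (Sum.elim a' Subtype.val) := fun φ =>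
    ⟨h φ, fun hφ => by
      by_contra hn
      exact (Formula.realize_not.1 (h φ.not (Formula.realize_not.2 hn))) hφ⟩
  refine tp_eq_iff.2 fun m φ b hb => ?_
  have := h' (φ.relabel (Sum.map id fun j => ⟨b j, hb j⟩))
  simp only [Formula.realize_relabel] at this
  have e : ∀ v : α → 𝕄, (Sum.elim v Subtype.val : α ⊕ B → 𝕄) ∘
      (Sum.map id fun j => ⟨b j, hb j⟩) = Sum.elim v b := fun v => by
    funext z; rcases z with z | z <;> rfl
  rwa [e, e] at this

theorem tp_mono {B' : Set 𝕄} (hB : B' ⊆ B) (h : tp L B a = tp L B a') :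
    tp L B' a = tp L B' a' :=
  tp_eq_iff.2 fun m φ b hb => tp_eq_iff.1 h m φ b fun j => hB (hb j)

theorem tp_comp (h : tp L B a = tp L B a') (g : β → α) :
    tp L B (a ∘ g) = tp L B (a' ∘ g) := by
  refine tp_eq_iff.2 fun m φ b hb => ?_
  have := tp_eq_iff.1 h m (φ.relabel (Sum.map g id)) b hb
  simpa only [Formula.realize_relabel, Sum.elim_comp_map, Function.comp_id] using this

/-- The type of a tuple is determined by the types of its finite subtuples. -/
theorem tp_eq_of_fin (h : ∀ (n : ℕ) (g : Fin n → α), tp L B (a ∘ g) = tp L B (a' ∘ g)) :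
    tp L B a = tp L B a' := by
  refine tp_eq_iff.2 fun m φ b hb => ?_
  obtain ⟨N, g, ψ', -, hψ⟩ := exists_fin_vars (𝕄 := 𝕄) (n := 1) (l := fun _ => Fin m) (fun _ => φ)
  rw [hψ 0, hψ 0]
  exact tp_eq_iff.1 (h N g) m _ b hb

/-- Tuples from `B` may be added to tuples with the same type over `B`. -/
theorem tp_sum_elim_param (h : tp L B a = tp L B a') {c : γ → 𝕄} (hc : ∀ j, c j ∈ B) :
    tp L B (Sum.elim a c) = tp L B (Sum.elim a' c) := by
  refine tp_eq_iff.2 fun m φ b hb => ?_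
  have := realize_iff_of_tp_eq h
    (φ.relabel (Equiv.sumAssoc α γ (Fin m))) (c := Sum.elim c b) (by rintro (j | j); exacts [hc j, hb j])
  simp only [Formula.realize_relabel] at this
  have e : ∀ v : α → 𝕄, (Sum.elim v (Sum.elim c b)) ∘ (Equiv.sumAssoc α γ (Fin m)) =
      Sum.elim (Sum.elim v c) b := fun v => by
    funext z; rcases z with (z | z) | z <;> rfl
  rwa [e, e] at this

section Automorphisms

variable (σ : 𝕄 ≃[L] 𝕄)

theorem realize_aut (φ : L.Formula α) (v : α → 𝕄) : φ.Realize (σ ∘ v) ↔ φ.Realize v :=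
  StrongHomClass.realize_formula σ φ

theorem realize_aut_sum_elim (φ : L.Formula (α ⊕ γ)) (v : α → 𝕄) (c : γ → 𝕄) :
    φ.Realize (Sum.elim (σ ∘ v) (σ ∘ c)) ↔ φ.Realize (Sum.elim v c) := by
  rw [← Sum.comp_elim, realize_aut]

variable {σ}

theorem tp_aut (hσ : ∀ b ∈ B, σ b = b) (a : α → 𝕄) : tp L B (σ ∘ a) = tp L B a := by
  refine tp_eq_iff.2 fun m φ b hb => ?_
  have : b = σ ∘ b := funext fun j => (hσ _ (hb j)).symm
  conv_lhs => rw [this, realize_aut_sum_elim]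

theorem tp_image_aut (h : tp L B a = tp L B a') (σ : 𝕄 ≃[L] 𝕄) :
    tp L (σ '' B) (σ ∘ a) = tp L (σ '' B) (σ ∘ a') := by
  refine tp_eq_iff.2 fun m φ b hb => ?_
  choose c hc hcb using hb
  obtain rfl : σ ∘ c = b := funext hcb
  rw [realize_aut_sum_elim, realize_aut_sum_elim]
  exact tp_eq_iff.1 h m φ c hc

theorem symm_fixes {B : Set 𝕄} (hσ : ∀ b ∈ B, σ b = b) : ∀ b ∈ B, σ.symm b = b := fun b hb => by
  conv_lhs => rw [← hσ b hb]
  exact σ.symm_apply_apply b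

theorem image_eq_of_fixes {B : Set 𝕄} (hσ : ∀ b ∈ B, σ b = b) : σ '' B = B := by
  ext z
  exact ⟨by rintro ⟨b, hb, rfl⟩; rwa [hσ b hb], fun hz => ⟨z, hz, hσ z hz⟩⟩

end Automorphisms

end Formulas
/-! ### Limit types along ultrafilters -/

section Ultra

variable {L : FirstOrder.Language.{u, v}} {𝕄 : Type w} [L.Structure 𝕄] [Nonempty 𝕄]
  {X α γ : Type*}

/-- The ultrapower of `𝕄` by `D`. It is a separate definition so that the only structure on it for
the language with constants is that of the ultrapower of the expanded model. -/
def Ultrapower (𝕄 : Type w) (D : Ultrafilter X) := (D : Filter X).Product fun _ => 𝕄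

instance (B : Set 𝕄) (D : Ultrafilter X) : L[[B]].Structure (Ultrapower 𝕄 D) :=
  Ultraproduct.structure (M := fun _ : X => 𝕄)

instance (D : Ultrafilter X) : Nonempty (Ultrapower 𝕄 D) :=
  Ultraproduct.Product.instNonempty (M := fun _ : X => 𝕄)

instance ultrapower_models (B : Set 𝕄) (D : Ultrafilter X) :
    Ultrapower 𝕄 D ⊨ L[[B]].completeTheory 𝕄 :=
  ⟨fun φ hφ => (Ultraproduct.sentence_realize (M := fun _ : X => 𝕄) φ).2
    (Eventually.of_forall fun _ => hφ)⟩

/-- The limit along the ultrafilter `D` of the types over `B` of the tuples `f t`: the complete type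
over `B` of the formulas that hold of `D`-almost all of these tuples. It is encoded as the type of
the tuple represented by `f` in the ultrapower of `𝕄`. -/
noncomputable def limType (L : FirstOrder.Language.{u, v}) {𝕄 : Type w} [L.Structure 𝕄] [Nonempty 𝕄]
    (B : Set 𝕄) (D : Ultrafilter X) (f : X → α → 𝕄) : TypesOver L B α :=
  (L[[B]].completeTheory 𝕄).typeOf (M := Ultrapower 𝕄 D)
    (fun i => ((fun t => f t i : X → 𝕄) : (D : Filter X).Product fun _ => 𝕄))

theorem contains_limType (B : Set 𝕄) (D : Ultrafilter X) (f : X → α → 𝕄) (θ : L[[B]].Formula α) :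
    Contains (limType L B D f) θ ↔ ∀ᶠ t in D, θ.Realize (f t) :=
  Theory.CompleteType.formula_mem_typeOf.trans
    (Ultraproduct.realize_formula_cast (M := fun _ : X => 𝕄) θ (fun i t => f t i))

theorem realizes_limType_iff {B : Set 𝕄} {D : Ultrafilter X} {f : X → α → 𝕄} {c : α → 𝕄} :
    Realizes L c (limType L B D f) ↔
      ∀ θ : L[[B]].Formula α, (∀ᶠ t in D, θ.Realize (f t)) → θ.Realize c := by
  constructor
  · intro h θ hθ
    rw [← contains_tp B, show tp L B c = _ from h, contains_limType]
    exact hθ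
  · intro h
    refine SetLike.ext fun φ => ?_
    obtain ⟨θ, rfl⟩ := Formula.equivSentence.surjective φ
    refine (contains_tp B c θ).trans (Iff.trans ?_ (contains_limType B D f θ).symm)
    refine ⟨fun hθ => ?_, h θ⟩
    by_contra hn
    rw [← Ultrafilter.eventually_not] at hn
    exact Formula.realize_not.1 (h θ.not (hn.mono fun t ht => Formula.realize_not.2 ht)) hθ

theorem Realizes.realize_iff {B : Set 𝕄} {D : Ultrafilter X} {f : X → α → 𝕄} {c : α → 𝕄}
    (h : Realizes L c (limType L B D f)) (φ : L.Formula (α ⊕ γ)) {b : γ → 𝕄} (hb : ∀ j, b j ∈ B) :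
    φ.Realize (Sum.elim c b) ↔ ∀ᶠ t in D, φ.Realize (Sum.elim (f t) b) := by
  have h1 := contains_tp B c (inst B φ fun j => ⟨b j, hb j⟩)
  rw [show tp L B c = _ from h, contains_limType, realize_inst] at h1
  simp only [realize_inst] at h1
  exact h1.symm

end Ultra

/-! ### Saturation and homogeneity -/

section Saturation

variable {L : FirstOrder.Language.{u, v}} {T : L.Theory} {𝕄 : Type w} [L.Structure 𝕄] [Nonempty 𝕄]
  {κ : Cardinal.{w}}

theorem IsMonster.union_lt (h𝕄 : IsMonster T 𝕄 κ) {B C : Set 𝕄} (hB : #B < κ) (hC : #C < κ) :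
    #(B ∪ C : Set 𝕄) < κ :=
  (Cardinal.mk_union_le B C).trans_lt (Cardinal.add_lt_of_lt h𝕄.aleph0_lt.le hB hC)

theorem mk_range_lt {α : Type x} (hα : Cardinal.lift.{w} #α < Cardinal.lift.{x} κ) (a : α → 𝕄) :
    #(Set.range a) < κ := by
  have := (Cardinal.mk_range_le_lift (f := a)).trans_lt hα
  exact Cardinal.lift_lt.1 this

/-- The monster model realizes limit types in fewer than `κ` variables over fewer than `κ`
parameters. Saturation supplies one coordinate at a time, and Zorn's lemma does the rest. -/
theorem IsMonster.exists_realizes_limType (h𝕄 : IsMonster T 𝕄 κ) {B : Set 𝕄} (hB : #B < κ)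
    {α : Type x} (hα : Cardinal.lift.{w} #α < Cardinal.lift.{x} κ) {X : Type*} (D : Ultrafilter X)
    (f : X → α → 𝕄) : ∃ c : α → 𝕄, Realizes L c (limType L B D f) := by
  classical
  -- `S` holds the graphs of the partial maps `α → 𝕄` that realize the restriction of the type
  let S : Set (Set (α × 𝕄)) := {G | ∀ φ : L.Formula (G ⊕ B),
    (∀ᶠ t in D, φ.Realize (Sum.elim (fun g => f t g.1.1) Subtype.val)) →
      φ.Realize (Sum.elim (fun g => g.1.2) Subtype.val)}
  obtain ⟨G, hG⟩ : ∃ G, Maximal (· ∈ S) G := by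
    refine zorn_subset S fun c hc hchain => ?_
    refine ⟨⋃₀ c, fun φ hφ => ?_, fun s hs => Set.subset_sUnion_of_mem hs⟩
    obtain ⟨N, g, ψ, -, hψ⟩ := exists_fin_vars (𝕄 := 𝕄) (n := 1) (l := fun _ => B) (fun _ => φ)
    simp only [hψ 0] at hφ ⊢
    rcases Set.eq_empty_or_nonempty c with rfl | hne
    · obtain ⟨t, ht⟩ := hφ.exists
      have e : ((fun g : (⋃₀ ∅ : Set (α × 𝕄)) => f t g.1.1) ∘ g) = (fun g => g.1.2) ∘ g :=
        funext fun j => absurd (g j).2 (by simp)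
      rwa [e] at ht
    obtain ⟨G, hGc, hgG⟩ : ∃ G ∈ c, ∀ i, (g i : α × 𝕄) ∈ G := by
      have := DirectedOn.exists_mem_subset_of_finite_of_subset_sUnion hne hchain.directedOn
        (Set.finite_range fun i => (g i : α × 𝕄)) (by rintro _ ⟨i, rfl⟩; exact (g i).2)
      obtain ⟨G, hG, h⟩ := this
      exact ⟨G, hG, fun i => h ⟨i, rfl⟩⟩
    have := hc hGc ((ψ 0).relabel (Sum.map (fun i => ⟨g i, hgG i⟩) id))
    simp only [Formula.realize_relabel, Sum.elim_comp_map, Function.comp_id] at this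
    exact this hφ
  have hGS : G ∈ S := hG.prop
  have hfun : ∀ g ∈ G, ∀ g' ∈ G, g.1 = g'.1 → g.2 = g'.2 := fun g hg g' hg' e => by
    have := hGS (Term.equal (Term.var (Sum.inl ⟨g, hg⟩)) (Term.var (Sum.inl ⟨g', hg'⟩)))
    simp only [Formula.realize_equal, Term.realize_var, Sum.elim_inl] at this
    exact this (Eventually.of_forall fun t => by rw [e])
  have hcard : #(Prod.snd '' G : Set 𝕄) < κ := by
    have : Function.Injective (fun g : G => g.1.1) := fun g g' e =>
      Subtype.ext (Prod.ext e (hfun g g.2 g' g'.2 e))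
    let k : Set.range (fun g : G => g.1.1) → 𝕄 := fun i => i.2.choose.1.2
    have hk : Prod.snd '' G ⊆ Set.range k := by
      rintro _ ⟨g, hg, rfl⟩
      refine ⟨⟨g.1, ⟨g, hg⟩, rfl⟩, ?_⟩
      have := (⟨⟨g, hg⟩, rfl⟩ : ∃ g' : G, g'.1.1 = g.1)
      exact hfun _ this.choose.2 _ hg this.choose_spec
    refine (Cardinal.mk_le_mk_of_subset hk).trans_lt (mk_range_lt ?_ k)
    exact (Cardinal.lift_le.2 (Cardinal.mk_set_le _)).trans_lt hα
  have htot : ∀ i : α, ∃ y, (i, y) ∈ G := by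
    intro i
    -- `F` is generated by the conditions on the value at `i`
    let F : Filter 𝕄 :=
      { sets := {U | ∃ φ : L.Formula ((G ⊕ B) ⊕ Fin 1),
          (∀ᶠ t in D, φ.Realize (Sum.elim (Sum.elim (fun g => f t g.1.1) Subtype.val)
            (fun _ => f t i))) ∧
          ∀ y, φ.Realize (Sum.elim (Sum.elim (fun g => g.1.2) Subtype.val) (fun _ => y)) → y ∈ U}
        univ_sets := ⟨⊤, by simp, by simp⟩
        sets_of_superset := by
          rintro U V ⟨φ, h1, h2⟩ hUV
          exact ⟨φ, h1, fun y hy => hUV (h2 y hy)⟩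
        inter_sets := by
          rintro U V ⟨φ, h1, h2⟩ ⟨ψ, h3, h4⟩
          refine ⟨φ ⊓ ψ, ?_, ?_⟩
          · filter_upwards [h1, h3] with t h5 h6
            exact Formula.realize_inf.2 ⟨h5, h6⟩
          · intro y hy
            rw [Formula.realize_inf] at hy
            exact ⟨h2 y hy.1, h4 y hy.2⟩ }
    have hF : F.NeBot := by
      refine ⟨fun hbot => ?_⟩
      have : (∅ : Set 𝕄) ∈ F := by rw [hbot]; trivial
      obtain ⟨φ, h1, h2⟩ := this
      have := hGS (φ.iExs (Fin 1))
      simp only [Formula.realize_iExs] at this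
      obtain ⟨y, hy⟩ := this (h1.mono fun t ht => ⟨_, ht⟩)
      refine h2 (y 0) ?_
      convert hy using 3 with j
      rw [Subsingleton.elim j 0]
    obtain ⟨p, hp⟩ := h𝕄.saturated (B ∪ Prod.snd '' G) (h𝕄.union_lt hB hcard) 1
      (limType L _ (Ultrafilter.of F) fun y _ => y)
    refine ⟨p 0, ?_⟩
    have hins : insert (i, p 0) G ∈ S := by
      intro χ hχ
      let r : (insert (i, p 0) G : Set (α × 𝕄)) ⊕ B → (G ⊕ B) ⊕ Fin 1 :=
        Sum.elim (fun g => if h : g.1 ∈ G then Sum.inl (Sum.inl ⟨g, h⟩) else Sum.inr 0)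
          (fun b => Sum.inl (Sum.inr b))
      have hr : ∀ (v : α × 𝕄 → 𝕄), (Sum.elim (Sum.elim (fun g => v g.1) Subtype.val)
          (fun _ => v (i, p 0))) ∘ r = Sum.elim (fun g => v g.1) Subtype.val := by
        intro v
        funext z
        rcases z with ⟨g, hg⟩ | z
        · by_cases h : g ∈ G
          · simp [r, h]
          · obtain rfl : g = (i, p 0) := hg.resolve_right h
            simp [r, h]
        · simp [r]
      have hU : {y : 𝕄 | (χ.relabel r).Realize (Sum.elim (Sum.elim (fun g => g.1.2) Subtype.val)
          (fun _ => y))} ∈ F := by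
        refine ⟨χ.relabel r, ?_, fun y hy => hy⟩
        filter_upwards [hχ] with t ht
        rw [Formula.realize_relabel]
        have := hr (fun g => f t g.1)
        rwa [this]
      have h1 := (Realizes.realize_iff hp (((χ.relabel r)).relabel Sum.swap)
        (b := Sum.elim (fun g : G => g.1.2) Subtype.val) (by
          rintro (g | b)
          · exact Or.inr ⟨g, g.2, rfl⟩
          · exact Or.inl b.2)).2 (by
            filter_upwards [Ultrafilter.of_le F hU] with y hy
            rw [Formula.realize_relabel]
            convert hy using 1
            funext z
            rcases z with z | z <;> rfl)
      rw [Formula.realize_relabel, Formula.realize_relabel] at h1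
      have := hr Prod.snd
      rw [← this]
      convert h1 using 1
      congr 1
      funext z
      rcases z with z | z
      · rfl
      · rw [Subsingleton.elim z 0]; rfl
    exact hG.le_of_ge hins (Set.subset_insert _ _) (Set.mem_insert _ _)
  choose c hc using htot
  refine ⟨c, realizes_limType_iff.2 fun θ hθ => ?_⟩
  obtain ⟨m, φ, b, hφ⟩ := exists_fin_inst (𝕄 := 𝕄) θ
  simp only [hφ] at hθ ⊢
  have := hGS (φ.relabel (Sum.map (fun i => ⟨(i, c i), hc i⟩) b))
  simp only [Formula.realize_relabel, Sum.elim_comp_map] at this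
  exact this hθ

/-- Tuples with the same type over `B` are conjugate over `B`. -/
theorem IsMonster.exists_aut (h𝕄 : IsMonster T 𝕄 κ) {B : Set 𝕄} (hB : #B < κ)
    {α : Type x} (hα : Cardinal.lift.{w} #α < Cardinal.lift.{x} κ) {a a' : α → 𝕄}
    (h : tp L B a = tp L B a') : ∃ σ : 𝕄 ≃[L] 𝕄, (∀ b ∈ B, σ b = b) ∧ σ ∘ a = a' := by
  obtain ⟨c, hc⟩ := Cardinal.mem_range_lift_of_le hα.le
  obtain ⟨α', rfl⟩ : ∃ α' : Type w, #α' = c := ⟨c.out, Cardinal.mk_out c⟩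
  obtain ⟨e⟩ := Cardinal.lift_mk_eq'.1 hc
  rw [← hc, Cardinal.lift_lt] at hα
  obtain ⟨σ, hσ⟩ := h𝕄.homogeneous (α' ⊕ B)
    (by rw [Cardinal.mk_sum, Cardinal.lift_id, Cardinal.lift_id]
        exact Cardinal.add_lt_of_lt h𝕄.aleph0_lt.le hα hB)
    (Sum.elim (a ∘ e) Subtype.val) (Sum.elim (a' ∘ e) Subtype.val)
    (fun φ => realize_iff_of_tp_eq (tp_comp h e) φ fun j => j.2)
  refine ⟨σ, fun b hb => hσ (Sum.inr ⟨b, hb⟩), funext fun i => ?_⟩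
  have := hσ (Sum.inl (e.symm i))
  simpa using this

end Saturation
/-! ### Ramsey's theorem -/

section Ramsey

/-- Ramsey's theorem for colourings of `n`-element sets of natural numbers with two colours; the
truth value `t` is the colour of the homogeneous set. -/
theorem exists_strictMono_homogeneous (n : ℕ) (P : (Fin n → ℕ) → Prop) :
    ∃ f : ℕ → ℕ, StrictMono f ∧ ∃ t : Prop, ∀ i : Fin n → ℕ, StrictMono i → (P (f ∘ i) ↔ t) := by
  induction n with
  | zero =>
    exact ⟨id, strictMono_id, P Fin.elim0, fun i _ => by rw [Subsingleton.elim (id ∘ i) Fin.elim0]⟩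
  | succ n ih =>
    -- the range of `F (k + 1)` lies in that of `F k`, and the colour of an increasing tuple that starts
    -- with `F k 0` and continues in the range of `F (k + 1)` is `t (F k)`
    choose g hg t ht using fun f : {f : ℕ → ℕ // StrictMono f} =>
      ih fun i => P (Fin.cons (f.1 0) (f.1 ∘ Nat.succ ∘ i))
    let F : ℕ → {f : ℕ → ℕ // StrictMono f} := fun k => Nat.rec ⟨id, strictMono_id⟩
      (fun _ f => ⟨f.1 ∘ Nat.succ ∘ g f, f.2.comp (Order.succ_strictMono.comp (hg f))⟩) k
    have hF : ∀ k, (F (k + 1)).1 = (F k).1 ∘ Nat.succ ∘ g (F k) := fun k => rfl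
    have hrange : ∀ k j, ∃ m, (F (k + j)).1 0 = (F k).1 m := by
      intro k j
      suffices ∀ l, ∃ m, (F (k + j)).1 l = (F k).1 m from this 0
      induction j with
      | zero => exact fun l => ⟨l, rfl⟩
      | succ j ihj =>
        intro l
        obtain ⟨m, hm⟩ := ihj (Nat.succ (g (F (k + j)) l))
        exact ⟨m, by rw [← hm, ← add_assoc, hF]; rfl⟩
    have hh : StrictMono fun k => (F k).1 0 :=
      strictMono_nat_of_lt_succ fun k => (F k).2 (Nat.succ_pos _)
    -- by the pigeonhole principle, infinitely many of these colours agree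
    obtain ⟨e, he, t', ht'⟩ : ∃ e : ℕ → ℕ, StrictMono e ∧ ∃ t' : Prop, ∀ k, t (F (e k)) ↔ t' := by
      by_cases h : ∃ᶠ k in atTop, t (F k)
      · obtain ⟨e, he, h⟩ := extraction_of_frequently_atTop h
        exact ⟨e, he, True, fun k => iff_true_intro (h k)⟩
      · obtain ⟨e, he, h⟩ := extraction_of_eventually_atTop (not_frequently.1 h)
        exact ⟨e, he, False, fun k => iff_false_intro (h k)⟩
    refine ⟨_, hh.comp he, t', fun i hi => ?_⟩
    have hlt : ∀ j : Fin n, e (i 0) + 1 ≤ e (i j.succ) := fun j => he (hi (Fin.succ_pos j))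
    choose w hw using fun j : Fin n =>
      hrange (e (i 0) + 1) (e (i j.succ) - (e (i 0) + 1))
    have hw' : ∀ j : Fin n, (F (e (i j.succ))).1 0 = (F (e (i 0) + 1)).1 (w j) := fun j => by
      rw [← hw j, Nat.add_sub_cancel' (hlt j)]
    have hwm : StrictMono w := fun j k hjk => by
      rw [← (F (e (i 0) + 1)).2.lt_iff_lt, ← hw', ← hw']
      exact hh (he (hi (Fin.succ_lt_succ_iff.2 hjk)))
    rw [← ht' (i 0), ← ht _ w hwm]
    refine iff_of_eq (congrArg P (funext fun j => ?_))
    refine Fin.cases rfl (fun j => ?_) j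
    exact hw' j

/-- There is an ultrafilter on the set of subsequences of `ℕ` that witnesses all instances of
Ramsey's theorem at once. -/
theorem exists_ultrafilter_homogeneous : ∃ U : Ultrafilter {f : ℕ → ℕ // StrictMono f},
    ∀ (n : ℕ) (P : (Fin n → ℕ) → Prop), ∀ᶠ f : {f : ℕ → ℕ // StrictMono f} in U,
      ∀ i j : Fin n → ℕ, StrictMono i → StrictMono j → (P (f.1 ∘ i) ↔ P (f.1 ∘ j)) := by
  let H : (Σ n : ℕ, (Fin n → ℕ) → Prop) → Set {f : ℕ → ℕ // StrictMono f} := fun p =>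
    {f | ∀ i j : Fin p.1 → ℕ, StrictMono i → StrictMono j → (p.2 (f.1 ∘ i) ↔ p.2 (f.1 ∘ j))}
  have hH : ∀ s : Finset (Σ n : ℕ, (Fin n → ℕ) → Prop), ∃ f, ∀ p ∈ s, f ∈ H p := by
    classical
    intro s
    induction s using Finset.induction_on with
    | empty => exact ⟨⟨id, strictMono_id⟩, by simp⟩
    | insert p s _ ih =>
      obtain ⟨f, hf⟩ := ih
      obtain ⟨g, hg, t, ht⟩ := exists_strictMono_homogeneous p.1 fun i => p.2 (f.1 ∘ i)
      refine ⟨⟨f.1 ∘ g, f.2.comp hg⟩, fun q hq => ?_⟩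
      rcases Finset.mem_insert.1 hq with rfl | hq
      · exact fun i j hi hj => (ht i hi).trans (ht j hj).symm
      · exact fun i j hi hj => hf q hq (g ∘ i) (g ∘ j) (hg.comp hi) (hg.comp hj)
  obtain ⟨U, hU⟩ := Ultrafilter.exists_ultrafilter_of_finite_inter_nonempty (Set.range H) (by
    classical
    intro T hT
    choose! q hq using hT
    obtain ⟨f, hf⟩ := hH (T.image q)
    refine ⟨f, fun s hs => ?_⟩
    rw [← hq hs]
    exact hf _ (Finset.mem_image_of_mem q hs))
  exact ⟨U, fun n P => hU ⟨⟨n, P⟩, rfl⟩⟩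

/-- An increasing finite sequence extends to an increasing infinite one that ends with an interval. -/
theorem exists_strictMono_extend {n N : ℕ} {i : Fin n → ℕ} (hi : StrictMono i) (hN : ∀ l, i l < N) :
    ∃ f : ℕ → ℕ, StrictMono f ∧ (∀ l : Fin n, f l = i l) ∧ ∀ l, f (n + l) = N + l := by
  refine ⟨fun l => if h : l < n then i ⟨l, h⟩ else N + (l - n), fun k l hkl => ?_, fun l => ?_,
    fun l => ?_⟩
  · dsimp only
    split_ifs with h1 h2 h2
    · exact hi hkl
    · exact (hN _).trans_le (Nat.le_add_right _ _)
    · omega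
    · omega
  · simp
  · simp

end Ramsey

/-! ### Indiscernible sequences -/

section Indiscernibles

variable {L : FirstOrder.Language.{u, v}} {T : L.Theory} {𝕄 : Type w} [L.Structure 𝕄] [Nonempty 𝕄]
  {κ : Cardinal.{w}} {ι : Type x} {B : Set 𝕄} {a : ℕ → ι → 𝕄}

theorem Indiscernible.tp_eq (h : Indiscernible L B a) {f g : ℕ → ℕ} (hf : StrictMono f)
    (hg : StrictMono g) : tp L B (uncurry (a ∘ f)) = tp L B (uncurry (a ∘ g)) := by
  refine tp_eq_of_fin fun n e => ?_
  obtain ⟨N, hN⟩ := (Set.finite_range fun i => (e i).1).bddAbove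
  have hN' : ∀ i, (e i).1 < N + 1 := fun i => Nat.lt_succ_of_le (hN ⟨i, rfl⟩)
  exact tp_comp (h (N + 1) (fun l => f l) (fun l => g l) (fun _ _ hkl => hf hkl)
    (fun _ _ hkl => hg hkl)) fun i => (⟨(e i).1, hN' i⟩, (e i).2)

theorem indiscernible_of_tp_eq (h : ∀ f : ℕ → ℕ, StrictMono f →
    tp L B (uncurry (a ∘ f)) = tp L B (uncurry a)) : Indiscernible L B a := by
  have key : ∀ (n : ℕ) (i : Fin n → ℕ), StrictMono i →
      tp L B (fun z : Fin n × ι => a (i z.1) z.2) = tp L B (fun z : Fin n × ι => a z.1 z.2) := by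
    intro n i hi
    obtain ⟨N, hN⟩ := (Set.finite_range i).bddAbove
    obtain ⟨f, hf, hfi, -⟩ := exists_strictMono_extend hi fun l => Nat.lt_succ_of_le (hN ⟨l, rfl⟩)
    have := tp_comp (h f hf) fun z : Fin n × ι => ((z.1 : ℕ), z.2)
    have e : (uncurry (a ∘ f)) ∘ (fun z : Fin n × ι => ((z.1 : ℕ), z.2)) =
        fun z => a (i z.1) z.2 := by
      funext z; simp [hfi]
    rw [e] at this
    exact this
  exact fun n i j hi hj => (key n i hi).trans (key n j hj).symm

theorem Indiscernible.mono {B' : Set 𝕄} (hB : B' ⊆ B) (h : Indiscernible L B a) :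
    Indiscernible L B' a :=
  fun n i j hi hj => tp_mono hB (h n i j hi hj)

theorem Indiscernible.image_aut (h : Indiscernible L B a) (σ : 𝕄 ≃[L] 𝕄) :
    Indiscernible L (σ '' B) (fun n => σ ∘ a n) :=
  fun n i j hi hj => tp_image_aut (h n i j hi hj) σ

theorem IsMonster.prod_lt (h𝕄 : IsMonster T 𝕄 κ)
    (hι : Cardinal.lift.{w} #ι < Cardinal.lift.{x} κ) :
    Cardinal.lift.{w} #(ℕ × ι) < Cardinal.lift.{x} κ := by
  rw [Cardinal.mk_prod, Cardinal.lift_mul]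
  have h0 : ℵ₀ ≤ Cardinal.lift.{x} κ := by simpa using h𝕄.aleph0_lt.le
  refine Cardinal.mul_lt_of_lt h0 ?_ ?_
  · simpa using h𝕄.aleph0_lt
  · simpa using hι

/-- Over a small set, every sequence gives rise to an indiscernible sequence each of whose
properties is shared by a subsequence of the given one. -/
theorem IsMonster.exists_indiscernible (h𝕄 : IsMonster T 𝕄 κ) (hB : #B < κ)
    (hι : Cardinal.lift.{w} #ι < Cardinal.lift.{x} κ) (a : ℕ → ι → 𝕄) :
    ∃ a' : ℕ → ι → 𝕄, Indiscernible L B a' ∧ ∀ φ : L.Formula ((ℕ × ι) ⊕ B),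
      φ.Realize (Sum.elim (uncurry a') Subtype.val) →
        ∃ f : ℕ → ℕ, StrictMono f ∧ φ.Realize (Sum.elim (uncurry (a ∘ f)) Subtype.val) := by
  obtain ⟨U, hU⟩ := exists_ultrafilter_homogeneous
  obtain ⟨c, hc⟩ := h𝕄.exists_realizes_limType hB (h𝕄.prod_lt hι) U
    (fun f => uncurry (a ∘ f.1))
  refine ⟨curry c, fun n i j hi hj => ?_, fun φ hφ => ?_⟩
  · refine tp_eq_iff.2 fun m φ b hb => ?_
    have key : ∀ i : Fin n → ℕ,
        φ.Realize (Sum.elim (fun z : Fin n × ι => curry c (i z.1) z.2) b) ↔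
          ∀ᶠ f : {f : ℕ → ℕ // StrictMono f} in U,
            φ.Realize (Sum.elim (fun z : Fin n × ι => a ((f.1 ∘ i) z.1) z.2) b) := by
      intro i
      have := hc.realize_iff (φ.relabel (Sum.map (fun z : Fin n × ι => (i z.1, z.2)) id)) hb
      simp only [Formula.realize_relabel, Sum.elim_comp_map, Function.comp_id] at this
      exact this
    rw [key, key]
    refine eventually_congr ?_
    filter_upwards [hU n fun k =>
      φ.Realize (Sum.elim (fun z : Fin n × ι => a (k z.1) z.2) b)] with f hf
    exact hf i j hi hj
  · rw [uncurry_curry, hc.realize_iff φ fun j => j.2] at hφ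
    obtain ⟨f, hf⟩ := hφ.exists
    exact ⟨f.1, f.2, hf⟩

theorem Indiscernible.exists_aut (h𝕄 : IsMonster T 𝕄 κ) (hB : #B < κ)
    (hι : Cardinal.lift.{w} #ι < Cardinal.lift.{x} κ) (h : Indiscernible L B a) {f g : ℕ → ℕ}
    (hf : StrictMono f) (hg : StrictMono g) :
    ∃ σ : 𝕄 ≃[L] 𝕄, (∀ b ∈ B, σ b = b) ∧ ∀ l, σ ∘ a (f l) = a (g l) := by
  obtain ⟨σ, hσ, e⟩ := h𝕄.exists_aut hB (h𝕄.prod_lt hι) (h.tp_eq hf hg)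
  exact ⟨σ, hσ, fun l => funext fun j => congrFun e (l, j)⟩

theorem indiscernible_of_exists_aut (h : ∀ f : ℕ → ℕ, StrictMono f →
    ∃ σ : 𝕄 ≃[L] 𝕄, (∀ b ∈ B, σ b = b) ∧ ∀ l, σ ∘ a l = a (f l)) : Indiscernible L B a := by
  refine indiscernible_of_tp_eq fun f hf => ?_
  obtain ⟨σ, hσ, e⟩ := h f hf
  have : uncurry (a ∘ f) = σ ∘ uncurry a := funext fun z => (congrFun (e z.1) z.2).symm
  rw [this, tp_aut hσ]

end Indiscernibles
/-! ### Nonforking -/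

section Nonforking

variable {L : FirstOrder.Language.{u, v}} {T : L.Theory} {𝕄 : Type w} [L.Structure 𝕄] [Nonempty 𝕄]
  {κ : Cardinal.{w}} {α β γ : Type*} {A B B' C D : Set 𝕄}

/-- The filter on the set of `α`-tuples that is generated by the complements of the sets defined by
formulas dividing over `A`. A formula forks over `A` if and only if it fails eventually along this
filter, so that ultrafilters below it are the global types that do not fork over `A`. -/
def nonforkingFilter (L : FirstOrder.Language.{u, v}) {𝕄 : Type w} [L.Structure 𝕄] [Nonempty 𝕄]
    (A : Set 𝕄) (α : Type*) : Filter (α → 𝕄) :=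
  generate {U | ∃ (m : ℕ) (ψ : L.Formula (α ⊕ Fin m)) (d : Fin m → 𝕄), Divides A ψ d ∧
    U = {z | ¬ ψ.Realize (Sum.elim z d)}}

theorem forks_iff {m : ℕ} (φ : L.Formula (α ⊕ Fin m)) (b : Fin m → 𝕄) :
    Forks A φ b ↔ ∀ᶠ z in nonforkingFilter L A α, ¬ φ.Realize (Sum.elim z b) := by
  constructor
  · rintro ⟨n, l, ψ, c, himp, hdiv⟩
    have : ∀ᶠ z in nonforkingFilter L A α, ∀ i, ¬ (ψ i).Realize (Sum.elim z (c i)) :=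
      eventually_all.2 fun i => GenerateSets.basic ⟨l i, ψ i, c i, hdiv i, rfl⟩
    filter_upwards [this] with z hz hφ
    obtain ⟨i, hi⟩ := himp z hφ
    exact hz i hi
  · intro h
    obtain ⟨t, ht, hfin, hsub⟩ := mem_generate_iff.1 h
    choose m' ψ d hd e using fun U : t => ht U.2
    have := hfin.to_subtype
    obtain ⟨n, ⟨eq⟩⟩ := Finite.exists_equiv_fin t
    refine ⟨n, fun i => m' (eq.symm i), fun i => ψ (eq.symm i), fun i => d (eq.symm i),
      fun z hz => ?_, fun i => hd _⟩
    by_contra! hn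
    refine hsub (show z ∈ ⋂₀ t from fun U hU => ?_) hz
    obtain ⟨i, hi⟩ := eq.symm.surjective ⟨U, hU⟩
    rw [show U = (eq.symm i : Set (α → 𝕄)) by rw [hi], e]
    exact hn i

theorem Divides.forks {m : ℕ} {φ : L.Formula (α ⊕ Fin m)} {b : Fin m → 𝕄} (h : Divides A φ b) :
    Forks A φ b :=
  ⟨1, fun _ => m, fun _ => φ, fun _ => b, fun _ hz => ⟨0, hz⟩, fun _ => h⟩

theorem indep_iff_not_forks {a : α → 𝕄} : Indep L A a C ↔
    ∀ (m : ℕ) (φ : L.Formula (α ⊕ Fin m)) (b : Fin m → 𝕄), (∀ j, b j ∈ A ∪ C) →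
      φ.Realize (Sum.elim a b) → ¬ Forks A φ b := by
  constructor
  · intro h m φ b hb hφ hf
    refine h ⟨m, φ, b, ⟨inst _ φ fun j => ⟨b j, hb j⟩, ?_, fun z hz => ?_⟩, hf⟩
    · rwa [contains_tp, realize_inst]
    · rwa [realize_inst] at hz
  · rintro h ⟨m, φ, b, ⟨θ, hθ, himp⟩, hf⟩
    rw [contains_tp] at hθ
    obtain ⟨m', φ', b', e⟩ := exists_fin_inst (𝕄 := 𝕄) θ
    refine h m' φ' _ (fun j => (b' j).2) ((e a).1 hθ) ?_
    rw [forks_iff] at hf ⊢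
    filter_upwards [hf] with z hz hz'
    exact hz (himp z ((e z).2 hz'))

/-- A type does not fork over `A` if and only if it extends to a global type, given here as an
ultrafilter on the set of tuples, that does not fork over `A`. -/
theorem indep_iff_exists_ultrafilter {a : α → 𝕄} : Indep L A a C ↔
    ∃ U : Ultrafilter (α → 𝕄), ↑U ≤ nonforkingFilter L A α ∧
      Realizes L a (limType L (A ∪ C) U id) := by
  rw [indep_iff_not_forks]
  constructor
  · intro h
    let F : Filter (α → 𝕄) :=
      { sets := {U | ∃ θ : L[[(A ∪ C : Set 𝕄)]].Formula α, θ.Realize a ∧ ∀ z, θ.Realize z → z ∈ U}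
        univ_sets := ⟨⊤, by simp, by simp⟩
        sets_of_superset := by
          rintro U V ⟨θ, h1, h2⟩ hUV
          exact ⟨θ, h1, fun z hz => hUV (h2 z hz)⟩
        inter_sets := by
          rintro U V ⟨θ, h1, h2⟩ ⟨θ', h3, h4⟩
          refine ⟨θ ⊓ θ', Formula.realize_inf.2 ⟨h1, h3⟩, fun z hz => ?_⟩
          rw [Formula.realize_inf] at hz
          exact ⟨h2 z hz.1, h4 z hz.2⟩ }
    have hne : (nonforkingFilter L A α ⊓ F).NeBot := by
      rw [inf_neBot_iff]
      rintro s hs s' ⟨θ, h1, h2⟩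
      obtain ⟨m, φ, b, e⟩ := exists_fin_inst (𝕄 := 𝕄) θ
      have := h m φ _ (fun j => (b j).2) ((e a).1 h1)
      rw [forks_iff] at this
      by_contra hn
      refine this ?_
      filter_upwards [hs] with z hz hφ
      exact hn ⟨z, hz, h2 z ((e z).2 hφ)⟩
    refine ⟨Ultrafilter.of (nonforkingFilter L A α ⊓ F), (Ultrafilter.of_le _).trans inf_le_left,
      realizes_limType_iff.2 fun θ hθ => ?_⟩
    by_contra hn
    have : {z | ¬ θ.Realize z} ∈ F :=
      ⟨θ.not, Formula.realize_not.2 hn, fun z hz => Formula.realize_not.1 hz⟩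
    obtain ⟨z, h1, h2⟩ := (hθ.and ((Ultrafilter.of_le _).trans inf_le_right this)).exists
    exact h2 h1
  · rintro ⟨U, hU, ha⟩ m φ b hb hφ hf
    rw [ha.realize_iff φ hb] at hφ
    obtain ⟨z, h1, h2⟩ := (hφ.and (hU ((forks_iff φ b).1 hf))).exists
    exact h2 h1

theorem Divides.relabel {m : ℕ} {φ : L.Formula (β ⊕ Fin m)} {b : Fin m → 𝕄} (h : Divides A φ b)
    (g : β → α) : Divides A (φ.relabel (Sum.map g id)) b := by
  obtain ⟨k, c, hc, hcb, hk⟩ := h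
  refine ⟨k, c, hc, hcb, fun s hs ⟨z, hz⟩ => hk s hs ⟨z ∘ g, fun i hi => ?_⟩⟩
  have := hz i hi
  rwa [Formula.realize_relabel, Sum.elim_comp_map] at this

theorem Forks.relabel {m : ℕ} {φ : L.Formula (β ⊕ Fin m)} {b : Fin m → 𝕄} (h : Forks A φ b)
    (g : β → α) : Forks A (φ.relabel (Sum.map g id)) b := by
  obtain ⟨n, l, ψ, c, himp, hdiv⟩ := h
  refine ⟨n, l, fun i => (ψ i).relabel (Sum.map g id), c, fun z hz => ?_,
    fun i => (hdiv i).relabel g⟩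
  rw [Formula.realize_relabel, Sum.elim_comp_map] at hz
  obtain ⟨i, hi⟩ := himp _ hz
  exact ⟨i, by rwa [Formula.realize_relabel, Sum.elim_comp_map]⟩

theorem Indep.comp {a : α → 𝕄} (h : Indep L A a C) (g : β → α) : Indep L A (a ∘ g) C := by
  rw [indep_iff_not_forks] at h ⊢
  intro m φ b hb hφ hf
  refine h m (φ.relabel (Sum.map g id)) b hb ?_ (hf.relabel g)
  rwa [Formula.realize_relabel, Sum.elim_comp_map]

/-- Finite character of nonforking, in the variables of the type. -/
theorem indep_of_fin {a : α → 𝕄} (h : ∀ (n : ℕ) (g : Fin n → α), Indep L A (a ∘ g) C) :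
    Indep L A a C := by
  rw [indep_iff_not_forks]
  rintro m φ b hb hφ ⟨n, l, ψ, c, himp, hdiv⟩
  -- the variables are cut down to those of `φ` and of the dividing formulas that it implies
  obtain ⟨N, g, χ, hg, hχ⟩ := exists_fin_vars (𝕄 := 𝕄)
    (l := fun i => Fin ((Fin.cons m l : Fin (n + 1) → ℕ) i)) (Fin.cons φ ψ)
  have hsurj : ∀ z : Fin N → 𝕄, ∃ z' : α → 𝕄, z' ∘ g = z := fun z =>
    ⟨extend g z fun _ => Classical.arbitrary 𝕄, funext fun i => hg.extend_apply z _ i⟩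
  have h0 : ∀ (z : α → 𝕄), φ.Realize (Sum.elim z b) ↔ (χ 0).Realize (Sum.elim (z ∘ g) b) :=
    fun z => hχ 0 z b
  have hs : ∀ i (z : α → 𝕄) (d : Fin (l i) → 𝕄),
      (ψ i).Realize (Sum.elim z d) ↔ (χ i.succ).Realize (Sum.elim (z ∘ g) d) :=
    fun i z d => hχ i.succ z d
  refine indep_iff_not_forks.1 (h N g) m (χ 0) b hb ((h0 a).1 hφ)
    ⟨n, l, fun i => χ i.succ, c, fun z hz => ?_, fun i => ?_⟩
  · obtain ⟨z, rfl⟩ := hsurj z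
    obtain ⟨i, hi⟩ := himp z ((h0 z).2 hz)
    exact ⟨i, (hs i z _).1 hi⟩
  · obtain ⟨k, e, he, heb, hk⟩ := hdiv i
    refine ⟨k, e, he, heb, fun s hsk ⟨z, hz⟩ => ?_⟩
    obtain ⟨z, rfl⟩ := hsurj z
    exact hk s hsk ⟨z, fun j hj => (hs i z _).2 (hz j hj)⟩

theorem Indep.mono {a : α → 𝕄} (h : Indep L A a C) (hC : D ⊆ A ∪ C) : Indep L A a D := by
  rw [indep_iff_not_forks] at h ⊢
  intro m φ b hb
  exact h m φ b fun j => (hb j).elim Or.inl fun hj => hC hj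

theorem Divides.anti {m : ℕ} {φ : L.Formula (α ⊕ Fin m)} {b : Fin m → 𝕄} (hAB : A ⊆ B)
    (h : Divides B φ b) : Divides A φ b := by
  obtain ⟨k, c, hc, hcb, hk⟩ := h
  exact ⟨k, c, hc.mono hAB, fun i => tp_mono hAB (hcb i), hk⟩

theorem Indep.base_mono {a : α → 𝕄} (h : Indep L A a C) (hAB : A ⊆ B) (hB : B ⊆ A ∪ C) :
    Indep L B a C := by
  rw [indep_iff_not_forks] at h ⊢
  rintro m φ b hb hφ ⟨n, l, ψ, c, himp, hdiv⟩
  exact h m φ b (fun j => (hb j).elim (fun hj => hB hj) Or.inr) hφ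
    ⟨n, l, ψ, c, himp, fun i => (hdiv i).anti hAB⟩

theorem Divides.image_aut {m : ℕ} {φ : L.Formula (α ⊕ Fin m)} {b : Fin m → 𝕄}
    (h : Divides A φ b) (σ : 𝕄 ≃[L] 𝕄) : Divides (σ '' A) φ (σ ∘ b) := by
  obtain ⟨k, c, hc, hcb, hk⟩ := h
  refine ⟨k, fun i => σ ∘ c i, hc.image_aut σ, fun i => tp_image_aut (hcb i) σ,
    fun s hs ⟨z, hz⟩ => hk s hs ⟨σ.symm ∘ z, fun i hi => ?_⟩⟩
  rw [← realize_aut_sum_elim σ, ← comp_assoc]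
  have : (σ ∘ σ.symm : 𝕄 → 𝕄) = id := funext σ.apply_symm_apply
  rw [this]
  exact hz i hi

theorem Forks.image_aut {m : ℕ} {φ : L.Formula (α ⊕ Fin m)} {b : Fin m → 𝕄}
    (h : Forks A φ b) (σ : 𝕄 ≃[L] 𝕄) : Forks (σ '' A) φ (σ ∘ b) := by
  obtain ⟨n, l, ψ, c, himp, hdiv⟩ := h
  refine ⟨n, l, ψ, fun i => σ ∘ c i, fun z hz => ?_, fun i => (hdiv i).image_aut σ⟩
  have e : z = σ ∘ (σ.symm ∘ z) := funext fun j => (σ.apply_symm_apply _).symm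
  rw [e, realize_aut_sum_elim] at hz
  obtain ⟨i, hi⟩ := himp _ hz
  refine ⟨i, ?_⟩
  rwa [e, realize_aut_sum_elim]

theorem Indep.image_aut {a : α → 𝕄} (h : Indep L A a C) (σ : 𝕄 ≃[L] 𝕄) :
    Indep L (σ '' A) (σ ∘ a) (σ '' C) := by
  rw [indep_iff_not_forks] at h ⊢
  intro m φ b hb hφ hf
  rw [← Set.image_union] at hb
  choose b' hb' e using hb
  obtain rfl : σ ∘ b' = b := funext e
  rw [realize_aut_sum_elim] at hφ
  refine h m φ b' hb' hφ ?_
  have := hf.image_aut σ.symm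
  have e1 : (σ.symm ∘ σ : 𝕄 → 𝕄) = id := funext σ.symm_apply_apply
  rwa [← Set.image_comp, ← comp_assoc, e1, Set.image_id, id_comp] at this

variable (L) in
/-- Nonforking independence of sets, `B ⫝_A C`, where `B` is regarded as a tuple indexed by
itself. -/
abbrev SetIndep (A B C : Set 𝕄) : Prop :=
  Indep L A (fun b : B => (b : 𝕄)) C

theorem SetIndep.indep (h : SetIndep L A B C) {a : α → 𝕄} (ha : ∀ i, a i ∈ B) : Indep L A a C :=
  Indep.comp h fun i => ⟨a i, ha i⟩

theorem setIndep_of_fin (h : ∀ (n : ℕ) (b : Fin n → 𝕄), (∀ i, b i ∈ B) → Indep L A b C) :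
    SetIndep L A B C :=
  indep_of_fin fun n g => h n _ fun i => (g i).2

theorem Indep.setIndep {a : α → 𝕄} (h : Indep L A a C) : SetIndep L A (Set.range a) C := by
  choose g hg using fun b : Set.range a => b.2
  have := h.comp g
  rwa [show a ∘ g = fun b : Set.range a => (b : 𝕄) from funext hg] at this

theorem SetIndep.mono_left (h : SetIndep L A B C) (hB : B' ⊆ B) : SetIndep L A B' C :=
  h.indep fun i => hB i.2

theorem SetIndep.image_aut (h : SetIndep L A B C) (σ : 𝕄 ≃[L] 𝕄) :
    SetIndep L (σ '' A) (σ '' B) (σ '' C) := by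
  have := (Indep.image_aut h σ).setIndep
  rwa [Set.range_comp, Subtype.range_coe] at this

theorem setIndep_iUnion_left {B : ℕ → Set 𝕄} (hB : Monotone B) (h : ∀ k, SetIndep L A (B k) C) :
    SetIndep L A (⋃ k, B k) C := by
  refine setIndep_of_fin fun n b hb => ?_
  choose k hk using fun i => Set.mem_iUnion.1 (hb i)
  obtain ⟨N, hN⟩ := (Set.finite_range k).bddAbove
  exact (h N).indep fun i => hB (hN ⟨i, rfl⟩) (hk i)

theorem indep_iUnion_right {a : α → 𝕄} {C : ℕ → Set 𝕄} (hC : Monotone C)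
    (h : ∀ k, Indep L A a (C k)) : Indep L A a (⋃ k, C k) := by
  rw [indep_iff_not_forks]
  intro m φ b hb
  have : ∀ j, ∃ k, b j ∈ A ∪ C k := fun j => (hb j).elim (fun hj => ⟨0, Or.inl hj⟩) fun hj =>
    (Set.mem_iUnion.1 hj).imp fun k hk => Or.inr hk
  choose k hk using this
  obtain ⟨N, hN⟩ := (Set.finite_range k).bddAbove
  exact indep_iff_not_forks.1 (h N) m φ b fun j =>
    (hk j).imp id fun hj => hC (hN ⟨j, rfl⟩) hj

/-- The extension property of nonforking: the conjugate `σ '' B` of `B` realizes over `D ⊇ C` a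
nonforking extension of the type of `B` over `A ∪ C`. -/
theorem IsMonster.exists_aut_setIndep (h𝕄 : IsMonster T 𝕄 κ) (hA : #A < κ) (hB : #B < κ)
    (hC : #C < κ) (hD : #D < κ) (hCD : C ⊆ D) (h : SetIndep L A B C) :
    ∃ σ : 𝕄 ≃[L] 𝕄, (∀ z ∈ A ∪ C, σ z = z) ∧ SetIndep L A (σ '' B) D := by
  obtain ⟨U, hU, hb⟩ := indep_iff_exists_ultrafilter.1 h
  have hB' : Cardinal.lift.{w} #B < Cardinal.lift.{w} κ := Cardinal.lift_lt.2 hB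
  obtain ⟨c, hc⟩ := h𝕄.exists_realizes_limType (h𝕄.union_lt hA hD) hB' U id
  have htp : tp L (A ∪ C) (fun b : B => (b : 𝕄)) = tp L (A ∪ C) c := by
    refine tp_eq_iff.2 fun m φ b' hb' => ?_
    rw [hb.realize_iff φ hb',
      hc.realize_iff φ fun j => Set.union_subset_union_right A hCD (hb' j)]
  obtain ⟨σ, hσ, e⟩ := h𝕄.exists_aut (h𝕄.union_lt hA hC) hB' htp
  refine ⟨σ, hσ, ?_⟩
  have := (indep_iff_exists_ultrafilter.2 ⟨U, hU, hc⟩).setIndep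
  rwa [← e, Set.range_comp, Subtype.range_coe] at this

end Nonforking
/-! ### Left transitivity of nonforking -/

section Transitivity

variable {L : FirstOrder.Language.{u, v}} {T : L.Theory} {𝕄 : Type w} [L.Structure 𝕄] [Nonempty 𝕄]
  {κ : Cardinal.{w}} {α β γ : Type*} {A B B' C D : Set 𝕄}

/-- A formula `φ(x; d)` true of `a` does not divide if `a` is independent from `d`; here the tuple
`d` may be infinite. -/
theorem Indep.exists_realize {a : α → 𝕄} (h : Indep L A a C) (φ : L.Formula (α ⊕ γ)) {d : γ → 𝕄}
    (hd : ∀ j, d j ∈ A ∪ C) (hφ : φ.Realize (Sum.elim a d)) {c : ℕ → γ → 𝕄}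
    (hc : Indiscernible L A c) (hcd : ∀ i, tp L A (c i) = tp L A d) (k : ℕ) :
    ∃ s : Finset ℕ, s.card = k ∧ ∃ z : α → 𝕄, ∀ i ∈ s, φ.Realize (Sum.elim z (c i)) := by
  obtain ⟨m, g, φ', e⟩ := exists_fin_params (𝕄 := 𝕄) φ
  by_contra! hn
  refine indep_iff_not_forks.1 h m φ' (d ∘ g) (fun j => hd _) ((e a d).1 hφ) (Divides.forks
    ⟨k, fun i => c i ∘ g, fun n i j hi hj => ?_, fun i => tp_comp (hcd i) g,
      fun s hs ⟨z, hz⟩ => ?_⟩)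
  · exact tp_comp (hc n i j hi hj) (Prod.map id g)
  · obtain ⟨i, hi, hφ⟩ := hn s hs z
    exact hφ ((e z _).2 (hz i hi))

/-- If `a` is independent from `d` over `A`, then some `b` has over each term of an
`A`-indiscernible sequence in `tp(d / A)` the type that `a` has over `d`. -/
theorem IsMonster.exists_common_realization (h𝕄 : IsMonster T 𝕄 κ) (hA : #A < κ) {α : Type x}
    (hα : Cardinal.lift.{w} #α < Cardinal.lift.{x} κ) {m : ℕ} {a : α → 𝕄} {d : Fin m → 𝕄}
    (h : Indep L A a (Set.range d)) {c : ℕ → Fin m → 𝕄} (hc : Indiscernible L A c)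
    (hcd : ∀ i, tp L A (c i) = tp L A d) :
    ∃ b : α → 𝕄, ∀ i, tp L A (Sum.elim b (c i)) = tp L A (Sum.elim a d) := by
  have hm : Cardinal.lift.{w} #(Fin m) < Cardinal.lift.{0} κ := by
    simpa using (Cardinal.natCast_lt_aleph0).trans h𝕄.aleph0_lt
  let c' : ℕ → A ⊕ Fin m → 𝕄 := fun i => Sum.elim Subtype.val (c i)
  let d' : A ⊕ Fin m → 𝕄 := Sum.elim Subtype.val d
  have hc' : Indiscernible L A c' := indiscernible_of_exists_aut fun f hf => by
    obtain ⟨σ, hσ, e⟩ := hc.exists_aut h𝕄 hA hm strictMono_id hf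
    refine ⟨σ, hσ, fun l => ?_⟩
    funext z
    rcases z with z | z
    · exact hσ z z.2
    · exact congrFun (e l) z
  have hcd' : ∀ i, tp L A (c' i) = tp L A d' := fun i => by
    have := tp_comp (tp_sum_elim_param (hcd i) (c := fun z : A => (z : 𝕄)) fun j => j.2) Sum.swap
    rwa [Sum.elim_swap, Sum.elim_swap] at this
  -- the filter generated by the conditions on `b`
  let F : Filter (α → 𝕄) :=
    { sets := {U | ∃ φ : L.Formula (α ⊕ (A ⊕ Fin m)), φ.Realize (Sum.elim a d') ∧
        ∃ k, ∀ z, (∀ i < k, φ.Realize (Sum.elim z (c' i))) → z ∈ U}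
      univ_sets := ⟨⊤, by simp, by simp⟩
      sets_of_superset := by
        rintro U V ⟨φ, h1, k, h2⟩ hUV
        exact ⟨φ, h1, k, fun z hz => hUV (h2 z hz)⟩
      inter_sets := by
        rintro U V ⟨φ, h1, k, h2⟩ ⟨ψ, h3, l, h4⟩
        refine ⟨φ ⊓ ψ, Formula.realize_inf.2 ⟨h1, h3⟩, max k l, fun z hz => ?_⟩
        simp only [Formula.realize_inf] at hz
        exact ⟨h2 z fun i hi => (hz i (hi.trans_le (le_max_left _ _))).1,
          h4 z fun i hi => (hz i (hi.trans_le (le_max_right _ _))).2⟩ }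
  have hF : F.NeBot := by
    refine ⟨fun hbot => ?_⟩
    have : (∅ : Set (α → 𝕄)) ∈ F := by rw [hbot]; trivial
    obtain ⟨φ, h1, k, h2⟩ := this
    obtain ⟨s, hs, z, hz⟩ := h.exists_realize φ (d := d') (by
      rintro (j | j)
      · exact Or.inl j.2
      · exact Or.inr ⟨j, rfl⟩) h1 hc' hcd' k
    -- by indiscernibility the `k` terms in question may be taken to be the first ones
    obtain ⟨N, hN⟩ := s.bddAbove
    obtain ⟨f, hf, hfi, -⟩ := exists_strictMono_extend (s.orderEmbOfFin hs).strictMono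
      fun l => Nat.lt_succ_of_le (hN (s.orderEmbOfFin_mem hs l))
    obtain ⟨σ, hσ, e⟩ := hc.exists_aut h𝕄 hA hm hf strictMono_id
    have e' : ∀ l, c' l = σ ∘ c' (f l) := fun l => by
      funext z
      rcases z with z | z
      · exact (hσ z z.2).symm
      · exact (congrFun (e l) z).symm
    refine h2 (σ ∘ z) fun i hi => ?_
    rw [e', realize_aut_sum_elim]
    refine hz _ ?_
    rw [show f i = s.orderEmbOfFin hs ⟨i, hi⟩ from hfi ⟨i, hi⟩]
    exact s.orderEmbOfFin_mem hs _
  have hE : #(⋃ i, Set.range (c i) : Set 𝕄) < κ := by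
    refine lt_of_le_of_lt ?_ h𝕄.aleph0_lt
    exact Cardinal.mk_le_aleph0_iff.2 (Set.countable_iUnion fun i => Set.countable_range _).to_subtype
  obtain ⟨b, hb⟩ := h𝕄.exists_realizes_limType (h𝕄.union_lt hA hE) hα (Ultrafilter.of F) id
  refine ⟨b, fun i => (tp_eq_of_imp fun φ hφ => ?_).symm⟩
  let r : (α ⊕ Fin m) ⊕ A → α ⊕ (A ⊕ Fin m) :=
    Sum.elim (Sum.map id Sum.inr) fun z => Sum.inr (Sum.inl z)
  have hr : ∀ (z : α → 𝕄) (y : Fin m → 𝕄), (Sum.elim z (Sum.elim Subtype.val y)) ∘ r =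
      Sum.elim (Sum.elim z y) Subtype.val := fun z y => by
    funext j
    rcases j with (j | j) | j <;> rfl
  have := (hb.realize_iff (φ.relabel r) (b := c' i) (by
    rintro (j | j)
    · exact Or.inl j.2
    · exact Or.inr (Set.mem_iUnion.2 ⟨i, j, rfl⟩))).2
    (Ultrafilter.of_le F ⟨φ.relabel r, by rwa [Formula.realize_relabel, hr], i + 1,
      fun z hz => hz i (Nat.lt_succ_self i)⟩)
  rwa [Formula.realize_relabel, hr] at this

/-- Transitivity of nondividing, for a formula: an `A`-indiscernible sequence starting with `d` may
be replaced by one that is indiscernible over `A ∪ B`, which then cannot witness dividing over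
`A ∪ B`. -/
theorem IsMonster.not_divides_of_setIndep (h𝕄 : IsMonster T 𝕄 κ) (hA : #A < κ) (hB : #B < κ)
    (h : SetIndep L A B D) (h' : SetIndep L (A ∪ B) B' D) {n m : ℕ} {e : Fin n → 𝕄}
    (he : ∀ i, e i ∈ B ∪ B') {d : Fin m → 𝕄} (hd : ∀ j, d j ∈ D) {ψ : L.Formula (Fin n ⊕ Fin m)}
    (hψ : ψ.Realize (Sum.elim e d)) : ¬ Divides A ψ d := by
  classical
  rintro ⟨k, c, hc, hcd, hk⟩
  have hm : Cardinal.lift.{w} #(Fin m) < Cardinal.lift.{0} κ := by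
    simpa using (Cardinal.natCast_lt_aleph0).trans h𝕄.aleph0_lt
  have hBl : Cardinal.lift.{w} #B < Cardinal.lift.{w} κ := Cardinal.lift_lt.2 hB
  obtain ⟨b, hb⟩ := h𝕄.exists_common_realization hA hBl (a := fun z : B => (z : 𝕄))
    (Indep.mono h (by rintro _ ⟨j, rfl⟩; exact Or.inr (hd j))) hc hcd
  -- an `Ab`-indiscernible sequence with the same type over `A` as `c`
  obtain ⟨c', hc', hcc'⟩ := h𝕄.exists_indiscernible
    (h𝕄.union_lt hA (mk_range_lt hBl b)) hm c
  have htp : tp L A (uncurry c') = tp L A (uncurry c) := tp_eq_of_imp fun φ hφ => by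
    obtain ⟨f, hf, hφ'⟩ := hcc' (φ.relabel (Sum.map id fun z : A => ⟨z, Or.inl z.2⟩)) (by
      rw [Formula.realize_relabel, Sum.elim_comp_map]; exact hφ)
    rw [Formula.realize_relabel, Sum.elim_comp_map] at hφ'
    exact (realize_iff_of_tp_eq (hc.tp_eq hf strictMono_id) φ fun j => j.2).1 hφ'
  have htp0 : tp L A (Sum.elim b (c' 0)) = tp L A (Sum.elim (fun z : B => (z : 𝕄)) d) :=
    tp_eq_of_imp fun φ hφ => by
      let r : (B ⊕ Fin m) ⊕ A → (ℕ × Fin m) ⊕ (A ∪ Set.range b : Set 𝕄) :=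
        Sum.elim (Sum.elim (fun z => Sum.inr ⟨b z, Or.inr ⟨z, rfl⟩⟩) fun j => Sum.inl (0, j))
          fun z => Sum.inr ⟨z, Or.inl z.2⟩
      have hr : ∀ c : ℕ → Fin m → 𝕄, (Sum.elim (uncurry c) Subtype.val) ∘ r =
          Sum.elim (Sum.elim b (c 0)) Subtype.val := fun c => by
        funext z
        rcases z with (z | z) | z <;> rfl
      obtain ⟨f, -, hφ'⟩ := hcc' (φ.relabel r) (by rwa [Formula.realize_relabel, hr])
      rw [Formula.realize_relabel, hr] at hφ'
      exact (realize_iff_of_tp_eq (hb (f 0)) φ fun j => j.2).1 hφ'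
  have hBm : Cardinal.lift.{w} #(B ⊕ Fin m) < Cardinal.lift.{w} κ := by
    rw [Cardinal.mk_sum, Cardinal.lift_lt]
    refine Cardinal.add_lt_of_lt h𝕄.aleph0_lt.le (by simpa using hB) (by simpa using hm)
  -- `τ` makes this sequence start with `d` and be indiscernible over `A ∪ B`
  obtain ⟨τ, hτ, eτ⟩ := h𝕄.exists_aut hA hBm htp0
  have hτb : ∀ z : B, τ (b z) = z := fun z => congrFun eτ (Sum.inl z)
  have hτ0 : τ ∘ c' 0 = d := funext fun j => congrFun eτ (Sum.inr j)
  have hind : Indiscernible L (A ∪ B) fun i => τ ∘ c' i := (hc'.image_aut τ).mono (by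
    rintro z (hz | hz)
    · exact ⟨z, Or.inl hz, hτ z hz⟩
    · exact ⟨b ⟨z, hz⟩, Or.inr ⟨_, rfl⟩, hτb ⟨z, hz⟩⟩)
  have hshift : ∀ f : ℕ → ℕ, StrictMono f → ∃ σ : 𝕄 ≃[L] 𝕄, (∀ z ∈ A ∪ B, σ z = z) ∧
      ∀ l, σ ∘ (τ ∘ c' l) = τ ∘ c' (f l) := fun f hf =>
    hind.exists_aut h𝕄 (h𝕄.union_lt hA hB) hm strictMono_id hf
  -- the coordinates of `e` in `B` are treated as parameters
  let p : {i // e i ∈ B} → 𝕄 := fun i => e i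
  let q : {i // e i ∉ B} → 𝕄 := fun i => e i
  let r : Fin n ⊕ Fin m → {i // e i ∉ B} ⊕ ({i // e i ∈ B} ⊕ Fin m) :=
    Sum.elim (fun i => if h : e i ∈ B then Sum.inr (Sum.inl ⟨i, h⟩) else Sum.inl ⟨i, h⟩)
      fun j => Sum.inr (Sum.inr j)
  have hr : ∀ z : {i // e i ∉ B} → 𝕄, ∃ z' : Fin n → 𝕄, ∀ y : Fin m → 𝕄,
      Sum.elim z (Sum.elim p y) ∘ r = Sum.elim z' y := fun z =>
    ⟨fun i => (Sum.elim z (Sum.elim p d) ∘ r) (Sum.inl i), fun y => by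
      funext j
      rcases j with j | j
      · by_cases h : e j ∈ B <;> simp [r, h]
      · rfl⟩
  have hq : Indep L (A ∪ B) q D := SetIndep.indep h' fun i => (he i).resolve_left i.2
  obtain ⟨s, hs, z, hz⟩ := hq.exists_realize (ψ.relabel r) (d := Sum.elim p d)
    (by
      rintro (j | j)
      · exact Or.inl (Or.inr j.2)
      · exact Or.inr (hd j))
    (by
      rw [Formula.realize_relabel]
      convert hψ using 1
      funext j
      rcases j with j | j
      · by_cases h : e j ∈ B <;> simp [r, h, p, q]
      · rfl)
    (c := fun i => Sum.elim p (τ ∘ c' i))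
    (indiscernible_of_exists_aut fun f hf => by
      obtain ⟨σ, hσ, eσ⟩ := hshift f hf
      refine ⟨σ, hσ, fun l => ?_⟩
      rw [Sum.comp_elim, eσ]
      congr 1
      exact funext fun i => hσ _ (Or.inr i.2))
    (fun i => by
      obtain ⟨σ, hσ, eσ⟩ := hshift (fun l => l + i) fun k l hkl => Nat.add_lt_add_right hkl i
      have : Sum.elim p (τ ∘ c' i) = σ ∘ Sum.elim p d := by
        rw [Sum.comp_elim, ← hτ0, eσ, zero_add]
        congr 1
        exact funext fun i => (hσ _ (Or.inr i.2)).symm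
      rw [this, tp_aut hσ]) k
  obtain ⟨ρ, hρ, eρ⟩ := h𝕄.exists_aut hA (h𝕄.prod_lt hm) htp
  obtain ⟨z', hz'⟩ := hr z
  refine hk s hs ⟨ρ ∘ τ.symm ∘ z', fun i hi => ?_⟩
  have hi' := hz i hi
  rw [Formula.realize_relabel, hz'] at hi'
  have e1 : c i = ρ ∘ c' i := funext fun j => (congrFun eρ (i, j)).symm
  have e2 : c' i = τ.symm ∘ (τ ∘ c' i) := funext fun j => (τ.symm_apply_apply _).symm
  rwa [e1, realize_aut_sum_elim, e2, realize_aut_sum_elim]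

/-- Left transitivity of nonforking. It follows from transitivity of nondividing because, by the
extension property, `B` and `B'` may be taken to be independent from the parameters of all dividing
formulas in question. -/
theorem IsMonster.setIndep_union (h𝕄 : IsMonster T 𝕄 κ) (hA : #A < κ) (hB : #B < κ)
    (hB' : #B' < κ) (hC : #C < κ) (h : SetIndep L A B C) (h' : SetIndep L (A ∪ B) B' C) :
    SetIndep L A (B ∪ B') C := by
  refine setIndep_of_fin fun n e he => indep_iff_not_forks.2 ?_
  rintro m φ b hb hφ ⟨N, l, ψ, d, himp, hdiv⟩
  let D : Set 𝕄 := C ∪ ⋃ i, Set.range (d i)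
  have hCD : C ⊆ D := Set.subset_union_left
  have hD : #D < κ := h𝕄.union_lt hC (lt_of_lt_of_le
    (Set.Finite.lt_aleph0 (Set.finite_iUnion fun i => Set.finite_range _)) h𝕄.aleph0_lt.le)
  have himage : ∀ {E : Set 𝕄}, #E < κ → ∀ σ : 𝕄 ≃[L] 𝕄, #(σ '' E) < κ := fun hE σ =>
    Cardinal.mk_image_le.trans_lt hE
  -- `B` and `B'` may be moved over `A ∪ C` so as to become independent from `D`
  obtain ⟨σ, hσ, h1⟩ := h𝕄.exists_aut_setIndep hA hB hC hD hCD h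
  have h2 := h'.image_aut σ
  rw [Set.image_union, image_eq_of_fixes fun z hz => hσ z (Or.inl hz),
    image_eq_of_fixes fun z hz => hσ z (Or.inr hz)] at h2
  obtain ⟨τ, hτ, h3⟩ := h𝕄.exists_aut_setIndep (h𝕄.union_lt hA (himage hB σ)) (himage hB' σ)
    hC hD hCD h2
  have hfix : τ ∘ σ ∘ b = b := funext fun j => by
    have : σ (b j) = b j := hσ _ (hb j)
    simp only [comp_apply, this]
    exact hτ _ ((hb j).imp Or.inl id)
  have hφ' : φ.Realize (Sum.elim (τ ∘ σ ∘ e) b) := by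
    rw [← hfix, realize_aut_sum_elim, realize_aut_sum_elim]
    exact hφ
  obtain ⟨i, hi⟩ := himp _ hφ'
  refine h𝕄.not_divides_of_setIndep hA (himage hB σ) h1 h3 (fun j => ?_) (fun j => ?_) hi (hdiv i)
  · rcases he j with hj | hj
    · left
      have : τ (σ (e j)) = σ (e j) := hτ _ (Or.inl (Or.inr ⟨_, hj, rfl⟩))
      exact ⟨e j, hj, this.symm⟩
    · right
      exact ⟨σ (e j), ⟨e j, hj, rfl⟩, rfl⟩
  · exact Or.inr (Set.mem_iUnion.2 ⟨i, j, rfl⟩)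

end Transitivity
/-! ### Sets that carry elementary substructures -/

section ElementarySets

variable {L : FirstOrder.Language.{u, v}} {𝕄 : Type w} [L.Structure 𝕄] [Nonempty 𝕄] {N : Set 𝕄}

/-- The Tarski–Vaught criterion in terms of `L`-formulas. In contrast to definable sets with
parameters, such formulas are easily transported by automorphisms. -/
theorem meetsDefinable_iff : L.MeetsDefinable N ↔
    ∀ (m : ℕ) (φ : L.Formula (Fin 1 ⊕ Fin m)) (b : Fin m → 𝕄), (∀ j, b j ∈ N) →
      (∃ z : 𝕄, φ.Realize (Sum.elim (fun _ => z) b)) →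
        ∃ z ∈ N, φ.Realize (Sum.elim (fun _ => z) b) := by
  constructor
  · rintro h m φ b hb ⟨z, hz⟩
    obtain ⟨z', h1, h2⟩ := h {z | φ.Realize (Sum.elim (fun _ => z) b)} ⟨z, hz⟩
      ⟨inst N φ fun j => ⟨b j, hb j⟩, by
        ext y
        refine Iff.trans ?_ (realize_inst N φ _ y).symm
        have e : (fun _ => y 0) = y := funext fun i => by rw [Subsingleton.elim i 0]
        exact iff_of_eq (congrArg (fun y => φ.Realize (Sum.elim y b)) e)⟩
    exact ⟨z', h2, h1⟩
  · rintro h D ⟨z, hz⟩ ⟨θ, hθ⟩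
    obtain ⟨m, φ, b, e⟩ := exists_fin_inst (𝕄 := 𝕄) θ
    have key : ∀ y : 𝕄, y ∈ D ↔ φ.Realize (Sum.elim (fun _ => y) fun j => (b j : 𝕄)) := fun y => by
      rw [← e]
      exact iff_of_eq (congrArg (fun S : Set (Fin 1 → 𝕄) => (fun _ => y) ∈ S) hθ)
    obtain ⟨y, h1, h2⟩ := h m φ _ (fun j => (b j).2) ⟨z, (key z).1 hz⟩
    exact ⟨y, (key y).2 h2, h1⟩

theorem meetsDefinable_image_aut (h : L.MeetsDefinable N) (σ : 𝕄 ≃[L] 𝕄) :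
    L.MeetsDefinable (σ '' N) := by
  rw [meetsDefinable_iff] at h ⊢
  rintro m φ b hb ⟨z, hz⟩
  choose b' hb' e using hb
  obtain rfl : σ ∘ b' = b := funext e
  obtain ⟨z, rfl⟩ := σ.surjective z
  obtain ⟨y, h1, h2⟩ := h m φ b' hb' ⟨z, (realize_aut_sum_elim σ φ (fun _ => z) b').1 hz⟩
  exact ⟨σ y, ⟨y, h1, rfl⟩, (realize_aut_sum_elim σ φ (fun _ => y) b').2 h2⟩

theorem exists_forall_mem_union {m : ℕ} {C : ℕ → Set 𝕄} (hC : Monotone C) {E : Set 𝕄}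
    {b : Fin m → 𝕄} (hb : ∀ j, b j ∈ (⋃ n, C n) ∪ E) : ∃ N, ∀ n ≥ N, ∀ j, b j ∈ C n ∪ E := by
  have : ∀ j, ∃ k, b j ∈ C k ∪ E := fun j => (hb j).elim
    (fun hj => (Set.mem_iUnion.1 hj).imp fun k hk => Or.inl hk) fun hj => ⟨0, Or.inr hj⟩
  choose k hk using this
  obtain ⟨N, hN⟩ := (Set.finite_range k).bddAbove
  exact ⟨N, fun n hn j => (hk j).imp (fun hj => hC ((hN ⟨j, rfl⟩).trans hn) hj) id⟩

theorem meetsDefinable_iUnion {N : ℕ → Set 𝕄} (hN : Monotone N)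
    (h : ∀ n, L.MeetsDefinable (N (n + 1))) : L.MeetsDefinable (⋃ n, N n) := by
  refine meetsDefinable_iff.2 fun m φ b hb hz => ?_
  obtain ⟨k, hk⟩ := exists_forall_mem_union hN (E := ∅) fun j => Or.inl (hb j)
  obtain ⟨z, h1, h2⟩ := meetsDefinable_iff.1 (h k) m φ b
    (fun j => (hk (k + 1) k.le_succ j).resolve_right id) hz
  exact ⟨z, Set.mem_iUnion.2 ⟨_, h1⟩, h2⟩

/-- Every set of size at most `μ` is contained in an elementary substructure of size at most `μ`;
the case where `𝕄` itself has at most `μ` elements is included. -/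
theorem exists_meetsDefinable {μ : Cardinal.{w}} (hμ : ℵ₀ ≤ μ)
    (hL : Cardinal.lift.{w} L.card ≤ Cardinal.lift.{max u v} μ) {B : Set 𝕄} (hB : #B ≤ μ) :
    ∃ N : Set 𝕄, B ⊆ N ∧ #N ≤ μ ∧ L.MeetsDefinable N := by
  rcases le_total μ #𝕄 with h | h
  · obtain ⟨S, hS, hc⟩ := exists_elementarySubstructure_card_eq L B μ hμ
      (Cardinal.lift_le.2 hB) hL (Cardinal.lift_le.2 h)
    exact ⟨S, hS, (Cardinal.lift_inj.1 hc).le, S.meetsDefinable⟩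
  · refine ⟨Set.univ, Set.subset_univ _, by rwa [Cardinal.mk_univ], ?_⟩
    rintro D hD -
    rwa [Set.inter_univ]

end ElementarySets

/-! ### Morley sequences and their continuations -/

section Construction

variable {L : FirstOrder.Language.{u, v}} {T : L.Theory} {𝕄 : Type w} [L.Structure 𝕄] [Nonempty 𝕄]
  {κ μ : Cardinal.{w}} {ι : Type x} {A B : Set 𝕄} {a J : ℕ → ι → 𝕄}

theorem entries_univ (a : ℕ → ι → 𝕄) : entries a Set.univ = Set.range (uncurry a) := by
  ext z
  simp [entries]

theorem mem_entries {s : Set ℕ} {i : ℕ} (hi : i ∈ s) (j : ι) : a i j ∈ entries a s :=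
  Set.mem_iUnion₂.2 ⟨i, hi, j, rfl⟩

theorem exists_of_mem_entries {s : Set ℕ} {z : 𝕄} (h : z ∈ entries a s) :
    ∃ i ∈ s, ∃ j, a i j = z := by
  obtain ⟨i, hi, j, rfl⟩ := Set.mem_iUnion₂.1 h
  exact ⟨i, hi, j, rfl⟩

theorem entries_mono (a : ℕ → ι → 𝕄) : Monotone (entries a) := fun _ _ hst =>
  Set.biUnion_subset_biUnion_left hst

theorem mk_entries_le (hμ : ℵ₀ ≤ μ) (hι : Cardinal.lift.{w} #ι ≤ Cardinal.lift.{x} μ)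
    (a : ℕ → ι → 𝕄) (s : Set ℕ) : #(entries a s) ≤ μ := by
  have h1 : #(entries a s) ≤ #(Set.range (uncurry a)) :=
    Cardinal.mk_le_mk_of_subset (entries_univ a ▸ entries_mono a (Set.subset_univ s))
  refine h1.trans (Cardinal.lift_le.{x}.1 (Cardinal.mk_range_le_lift.trans ?_))
  rw [Cardinal.mk_prod, Cardinal.lift_mul]
  refine Cardinal.mul_le_of_le (by simpa using hμ) (by simpa using hμ) (by simpa using hι)

/-- Tails of a Morley sequence are independent from the preceding initial segments. -/
theorem IsMonster.setIndep_entries (h𝕄 : IsMonster T 𝕄 κ) (hμ : ℵ₀ ≤ μ) (hμκ : μ < κ)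
    (hι : Cardinal.lift.{w} #ι ≤ Cardinal.lift.{x} μ) (hA : #A < κ) (ha : IsMorley L A a) (k : ℕ) :
    SetIndep L A (entries a (Set.Ici k)) (entries a (Set.Iio k)) := by
  obtain ⟨p, -, -, ha⟩ := ha
  have hcard : ∀ s, #(entries a s) < κ := fun s => (mk_entries_le hμ hι a s).trans_lt hμκ
  have key : ∀ r, SetIndep L A (entries a (Set.Icc k (k + r))) (entries a (Set.Iio k)) := by
    intro r
    induction r with
    | zero =>
      refine (ha k).setIndep.mono_left fun z hz => ?_
      obtain ⟨i, hi, j, rfl⟩ := exists_of_mem_entries hz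
      obtain rfl : i = k := le_antisymm hi.2 hi.1
      exact ⟨j, rfl⟩
    | succ r ih =>
      have h1 : SetIndep L (A ∪ entries a (Set.Icc k (k + r))) (Set.range (a (k + r + 1)))
          (entries a (Set.Iio k)) := by
        refine Indep.mono (((ha (k + r + 1)).setIndep).base_mono Set.subset_union_left ?_) ?_
        · refine Set.union_subset_union_right _ (entries_mono a fun i hi => ?_)
          exact Nat.lt_succ_of_le hi.2
        · refine Set.Subset.trans (entries_mono a fun i hi => ?_) Set.subset_union_right
          simp only [Set.mem_Iio] at hi ⊢
          omega
      refine (h𝕄.setIndep_union hA (hcard _) ?_ (hcard _) ih h1).mono_left fun z hz => ?_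
      · refine mk_range_lt ((hι.trans_lt ?_)) _
        exact Cardinal.lift_lt.2 hμκ
      · obtain ⟨i, hi, j, rfl⟩ := exists_of_mem_entries hz
        rcases Nat.lt_or_ge i (k + r + 1) with h | h
        · exact Or.inl (mem_entries (Set.mem_Icc.2 ⟨hi.1, Nat.le_of_lt_succ h⟩) j)
        · obtain rfl : i = k + r + 1 := le_antisymm hi.2 h
          exact Or.inr ⟨j, rfl⟩
  refine (setIndep_iUnion_left (fun r s hrs => entries_mono a (Set.Icc_subset_Icc_right
    (Nat.add_le_add_left hrs k))) key).mono_left fun z hz => ?_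
  obtain ⟨i, hi, j, rfl⟩ := exists_of_mem_entries hz
  exact Set.mem_iUnion.2 ⟨i, mem_entries (Set.mem_Icc.2 ⟨hi, Nat.le_add_left _ _⟩) j⟩

/-- The existence axiom, for tuples of arbitrary length. -/
theorem ExistenceAxiom.setIndep (hex : ExistenceAxiom L 𝕄 κ) (hB : #B < κ) (C : Set 𝕄) :
    SetIndep L B C ∅ := by
  refine setIndep_of_fin fun n c _ => indep_iff_not_forks.2 fun m φ b hb hφ hf => ?_
  have hb' : ∀ j, b j ∈ B := fun j => (hb j).resolve_right id
  refine hex B hB n (tp L B c) ⟨m, φ, b, ⟨inst B φ fun j => ⟨b j, hb' j⟩, ?_, fun z hz => ?_⟩, hf⟩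
  · rwa [contains_tp, realize_inst]
  · rwa [realize_inst] at hz

/-- The tails `a_k, a_{k+1}, …` and `a_N, a_{N+1}, …` of an indiscernible sequence are conjugate over
the terms before `a_k`. -/
theorem Indiscernible.exists_aut_shift (h𝕄 : IsMonster T 𝕄 κ) (hB : #B < κ)
    (hι : Cardinal.lift.{w} #ι < Cardinal.lift.{x} κ) (h : Indiscernible L B a) {k N : ℕ}
    (hk : k ≤ N) : ∃ σ : 𝕄 ≃[L] 𝕄, (∀ z ∈ B ∪ entries a (Set.Iio k), σ z = z) ∧
      ∀ l, σ ∘ a (k + l) = a (N + l) := by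
  obtain ⟨f, hf, h1, h2⟩ := exists_strictMono_extend (i := fun l : Fin k => (l : ℕ))
    (fun _ _ h => h) fun l => l.2.trans_le hk
  obtain ⟨σ, hσ, e⟩ := h.exists_aut h𝕄 hB hι strictMono_id hf
  refine ⟨σ, ?_, fun l => (e _).trans (by rw [h2])⟩
  rintro z (hz | hz)
  · exact hσ z hz
  · obtain ⟨i, hi, j, rfl⟩ := exists_of_mem_entries hz
    have := congrFun (e i) j
    rwa [h1 ⟨i, hi⟩] at this

variable (L) in
/-- The sequence `J` continues the sequence `a` over `B`: it has, over `B` and any initial segment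
of `a`, the type of the remaining part of `a`. For `a` indiscernible over `B` this means that the
concatenation of `a` and `J` is indiscernible over `B`. -/
def IsContinuation (B : Set 𝕄) (a J : ℕ → ι → 𝕄) : Prop :=
  ∀ k, ∃ σ : 𝕄 ≃[L] 𝕄, (∀ z ∈ B ∪ entries a (Set.Iio k), σ z = z) ∧ ∀ l, σ ∘ J l = a (k + l)

theorem IsMonster.exists_isContinuation (h𝕄 : IsMonster T 𝕄 κ) (hμ : ℵ₀ ≤ μ) (hμκ : μ < κ)
    (hι : Cardinal.lift.{w} #ι ≤ Cardinal.lift.{x} μ) (hB : #B < κ) (h : Indiscernible L B a) :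
    ∃ J : ℕ → ι → 𝕄, IsContinuation L B a J := by
  have hι' := hι.trans_lt (Cardinal.lift_lt.{w, x}.2 hμκ)
  have hcard : ∀ s, #(entries a s) < κ := fun s => (mk_entries_le hμ hι a s).trans_lt hμκ
  -- `J` realizes the limit of the types of the tails of `a`
  obtain ⟨c, hc⟩ := h𝕄.exists_realizes_limType (h𝕄.union_lt hB (hcard Set.univ)) (h𝕄.prod_lt hι')
    (hyperfilter ℕ) fun N => uncurry fun l => a (N + l)
  refine ⟨curry c, fun k => ?_⟩
  have : tp L (B ∪ entries a (Set.Iio k)) c =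
      tp L (B ∪ entries a (Set.Iio k)) (uncurry fun l => a (k + l)) := by
    refine tp_eq_iff.2 fun m φ b hb => ?_
    rw [hc.realize_iff φ fun j =>
      Set.union_subset_union_right B (entries_mono a (Set.subset_univ _)) (hb j)]
    have hN : ∀ᶠ N in (hyperfilter ℕ : Filter ℕ), (φ.Realize (Sum.elim
        (uncurry fun l => a (N + l)) b) ↔ φ.Realize (Sum.elim (uncurry fun l => a (k + l)) b)) := by
      filter_upwards [Nat.hyperfilter_le_atTop (eventually_ge_atTop k)] with N hN
      obtain ⟨σ, hσ, e⟩ := h.exists_aut_shift h𝕄 hB hι' hN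
      have e1 : (uncurry fun l => a (N + l)) = σ ∘ uncurry fun l => a (k + l) :=
        funext fun z => (congrFun (e z.1) z.2).symm
      have e2 : b = σ ∘ b := funext fun j => (hσ _ (hb j)).symm
      conv_lhs => rw [e1, e2, realize_aut_sum_elim]
    rw [eventually_congr hN, eventually_const]
  obtain ⟨σ, hσ, e⟩ := h𝕄.exists_aut (h𝕄.union_lt hB (hcard _)) (h𝕄.prod_lt hι') this
  exact ⟨σ, hσ, fun l => funext fun j => congrFun e (l, j)⟩

end Construction
/-! ### Bases over which the sequence is independent and indiscernible -/

section Construction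

variable {L : FirstOrder.Language.{u, v}} {T : L.Theory} {𝕄 : Type w} [L.Structure 𝕄] [Nonempty 𝕄]
  {κ μ : Cardinal.{w}} {ι : Type x} {A B : Set 𝕄} {a J : ℕ → ι → 𝕄}

variable (L) in
/-- The set `B ⊇ A` is of size at most `μ`, independent from the sequence `a` over `A`, and `a` is
indiscernible over `B`. -/
structure IsIndepBase (A : Set 𝕄) (a : ℕ → ι → 𝕄) (μ : Cardinal.{w}) (B : Set 𝕄) : Prop where
  subset : A ⊆ B
  card_le : #B ≤ μ
  indep : SetIndep L A B (entries a Set.univ)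
  indisc : Indiscernible L B a

theorem image_entries {σ : 𝕄 ≃[L] 𝕄} {b : ℕ → ι → 𝕄} {f : ℕ → ℕ}
    (h : ∀ l, σ ∘ b l = a (f l)) : σ '' entries b Set.univ = entries a (Set.range f) := by
  ext z
  constructor
  · rintro ⟨z, hz, rfl⟩
    obtain ⟨l, -, j, rfl⟩ := exists_of_mem_entries hz
    rw [show σ (b l j) = a (f l) j from congrFun (h l) j]
    exact mem_entries (Set.mem_range_self l) j
  · intro hz
    obtain ⟨_, ⟨l, rfl⟩, j, rfl⟩ := exists_of_mem_entries hz
    exact ⟨b l j, mem_entries (Set.mem_univ _) j, congrFun (h l) j⟩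

theorem image_symm_eq {σ : 𝕄 ≃[L] 𝕄} {B C : Set 𝕄} (h : σ '' B = C) : σ.symm '' C = B := by
  rw [← h, ← Set.image_comp, show (σ.symm ∘ σ : 𝕄 → 𝕄) = id from funext σ.symm_apply_apply,
    Set.image_id]

theorem IsIndepBase.union_continuation (h𝕄 : IsMonster T 𝕄 κ) (hμ : ℵ₀ ≤ μ) (hμκ : μ < κ)
    (hι : Cardinal.lift.{w} #ι ≤ Cardinal.lift.{x} μ) (ha : IsMorley L A a)
    (hB : IsIndepBase L A a μ B) (hJ : IsContinuation L B a J) :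
    IsIndepBase L A a μ (B ∪ entries J Set.univ) := by
  have hι' := hι.trans_lt (Cardinal.lift_lt.{w, x}.2 hμκ)
  have hcard : ∀ (b : ℕ → ι → 𝕄) s, #(entries b s) < κ := fun b s =>
    (mk_entries_le hμ hι b s).trans_lt hμκ
  have hBκ : #B < κ := hB.card_le.trans_lt hμκ
  have hA : #A < κ := (Cardinal.mk_le_mk_of_subset hB.subset).trans_lt hBκ
  have hI : entries a Set.univ = ⋃ k, entries a (Set.Iio k) := by
    refine Set.Subset.antisymm (fun z hz => ?_) (Set.iUnion_subset fun k =>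
      entries_mono a (Set.subset_univ _))
    obtain ⟨i, -, j, rfl⟩ := exists_of_mem_entries hz
    exact Set.mem_iUnion.2 ⟨i + 1, mem_entries (Set.mem_Iio.2 (Nat.lt_succ_self i)) j⟩
  have hImono : Monotone fun k => entries a (Set.Iio k) := fun k l hkl =>
    entries_mono a (Set.Iio_subset_Iio hkl)
  -- automorphisms over `B` and an initial segment of `a` that map the rest of `a` to `J`
  have hσ : ∀ k, ∃ σ : 𝕄 ≃[L] 𝕄, (∀ z ∈ B ∪ entries a (Set.Iio k), σ z = z) ∧
      (∀ E ⊆ B ∪ entries a (Set.Iio k), σ '' E = E) ∧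
        σ '' entries a (Set.Ici k) = entries J Set.univ := fun k => by
    obtain ⟨σ, hσ, e⟩ := hJ k
    refine ⟨σ.symm, symm_fixes hσ, fun E hE =>
      image_eq_of_fixes fun z hz => symm_fixes hσ z (hE hz), image_symm_eq ?_⟩
    rw [image_entries e]
    congr 1
    ext i
    exact ⟨by rintro ⟨l, rfl⟩; exact Nat.le_add_right k l, fun hi => ⟨i - k, Nat.add_sub_cancel' hi⟩⟩
  have hJI : SetIndep L A (entries J Set.univ) (entries a Set.univ) := by
    rw [hI]
    refine indep_iUnion_right hImono fun k => ?_
    obtain ⟨σ, -, e, eJ⟩ := hσ k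
    have := (h𝕄.setIndep_entries hμ hμκ hι hA ha k).image_aut σ
    rwa [e _ Set.subset_union_right, eJ,
      e A (hB.subset.trans Set.subset_union_left)] at this
  have hBIJ : SetIndep L A B (entries a Set.univ ∪ entries J Set.univ) := by
    rw [hI, Set.iUnion_union]
    refine indep_iUnion_right (fun k l hkl => Set.union_subset_union_left _ (hImono hkl))
      fun k => ?_
    obtain ⟨σ, -, e, eJ⟩ := hσ k
    have h1 : SetIndep L A B (entries a (Set.Iio k) ∪ entries a (Set.Ici k)) :=
      Indep.mono hB.indep (Set.Subset.trans (Set.union_subset (entries_mono a (Set.subset_univ _))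
        (entries_mono a (Set.subset_univ _))) Set.subset_union_right)
    have := h1.image_aut σ
    rwa [Set.image_union, e _ Set.subset_union_right, eJ,
      e A (hB.subset.trans Set.subset_union_left), e B Set.subset_union_left] at this
  refine ⟨hB.subset.trans Set.subset_union_left, ?_, ?_, fun n i j hi hj => ?_⟩
  · exact (Cardinal.mk_union_le _ _).trans
      (Cardinal.add_le_of_le hμ hB.card_le (mk_entries_le hμ hι J _))
  · rw [Set.union_comm]
    refine h𝕄.setIndep_union hA (hcard J _) hBκ (hcard a _) hJI ?_
    exact Indep.mono (Indep.base_mono hBIJ Set.subset_union_left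
      (Set.union_subset_union_right _ Set.subset_union_right))
      (Set.Subset.trans Set.subset_union_left Set.subset_union_right)
  · obtain ⟨k, hk⟩ := ((Set.finite_range i).union (Set.finite_range j)).bddAbove
    have hik : ∀ l, i l < k + 1 := fun l => Nat.lt_succ_of_le (hk (Or.inl ⟨l, rfl⟩))
    have hjk : ∀ l, j l < k + 1 := fun l => Nat.lt_succ_of_le (hk (Or.inr ⟨l, rfl⟩))
    obtain ⟨f, hf, hfi, hfk⟩ := exists_strictMono_extend hi hik
    obtain ⟨g, hg, hgj, hgk⟩ := exists_strictMono_extend hj hjk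
    obtain ⟨τ, hτ, eτ⟩ := hB.indisc.exists_aut h𝕄 hBκ hι' hf hg
    have h1 : tp L (B ∪ entries a (Set.Ici (k + 1))) (fun z : Fin n × ι => a (i z.1) z.2) =
        tp L (B ∪ entries a (Set.Ici (k + 1))) (fun z : Fin n × ι => a (j z.1) z.2) := by
      have hfix : ∀ z ∈ B ∪ entries a (Set.Ici (k + 1)), τ z = z := by
        rintro z (hz | hz)
        · exact hτ z hz
        · obtain ⟨l, hl, t, rfl⟩ := exists_of_mem_entries hz
          have := congrFun (eτ (n + (l - (k + 1)))) t
          rwa [hfk, hgk, Nat.add_sub_cancel' hl] at this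
      have e : (fun z : Fin n × ι => a (j z.1) z.2) = τ ∘ fun z => a (i z.1) z.2 := by
        funext z
        have := congrFun (eτ z.1) z.2
        rw [hfi, hgj] at this
        exact this.symm
      rw [e, tp_aut hfix]
    obtain ⟨σ, hσ, e, eJ⟩ := hσ (k + 1)
    have h2 := tp_image_aut h1 σ
    have h3 : ∀ i : Fin n → ℕ, (∀ l, i l < k + 1) →
        σ ∘ (fun z : Fin n × ι => a (i z.1) z.2) = fun z => a (i z.1) z.2 := fun i hi =>
      funext fun z => hσ _ (Or.inr (mem_entries (Set.mem_Iio.2 (hi _)) _))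
    rwa [h3 i hik, h3 j hjk, Set.image_union, e B Set.subset_union_left,
      eJ] at h2

theorem IsIndepBase.exists_model (h𝕄 : IsMonster T 𝕄 κ) (hex : ExistenceAxiom L 𝕄 κ)
    (hμ : ℵ₀ ≤ μ) (hμκ : μ < κ) (hL : Cardinal.lift.{w} L.card ≤ Cardinal.lift.{max u v} μ)
    (hι : Cardinal.lift.{w} #ι ≤ Cardinal.lift.{x} μ)
    (hB : IsIndepBase L A a μ B) :
    ∃ M : Set 𝕄, B ⊆ M ∧ L.MeetsDefinable M ∧ IsIndepBase L A a μ M := by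
  have hι' := hι.trans_lt (Cardinal.lift_lt.{w, x}.2 hμκ)
  have hIκ : #(entries a Set.univ) < κ := (mk_entries_le hμ hι a _).trans_lt hμκ
  have hBκ : #B < κ := hB.card_le.trans_lt hμκ
  have hA : #A < κ := (Cardinal.mk_le_mk_of_subset hB.subset).trans_lt hBκ
  -- a model independent from `a`
  obtain ⟨N, hBN, hN, hNd, hNi⟩ : ∃ N : Set 𝕄, B ⊆ N ∧ #N ≤ μ ∧ L.MeetsDefinable N ∧
      SetIndep L A N (entries a Set.univ) := by
    obtain ⟨N, hBN, hN, hNd⟩ := exists_meetsDefinable hμ hL hB.card_le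
    have hNκ := hN.trans_lt hμκ
    obtain ⟨σ, hσ, h1⟩ := h𝕄.exists_aut_setIndep hBκ hNκ (by simpa using h𝕄.aleph0_lt.pos) hIκ
      (Set.empty_subset _) (hex.setIndep hBκ N)
    have h2 := h𝕄.setIndep_union hA hBκ (Cardinal.mk_image_le.trans_lt hNκ) hIκ hB.indep
      (by rwa [Set.union_eq_self_of_subset_left hB.subset])
    refine ⟨σ '' N, fun z hz => ⟨z, hBN hz, hσ z (Or.inl hz)⟩, Cardinal.mk_image_le.trans hN,
      meetsDefinable_image_aut hNd σ, h2.mono_left Set.subset_union_right⟩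
  have hNκ := hN.trans_lt hμκ
  -- an `N`-indiscernible sequence modelled on `a`
  obtain ⟨a', ha', h⟩ := h𝕄.exists_indiscernible hNκ hι' a
  have hNi' : SetIndep L A N (entries a' Set.univ) := by
    refine indep_iff_not_forks.2 fun m φ b hb hφ hf => ?_
    have hb' : ∀ j, ∃ z : (ℕ × ι) ⊕ A, Sum.elim (uncurry a') Subtype.val z = b j := fun j => by
      rcases hb j with hj | hj
      · exact ⟨Sum.inr ⟨_, hj⟩, rfl⟩
      · obtain ⟨i, -, t, e⟩ := exists_of_mem_entries hj
        exact ⟨Sum.inl (i, t), e⟩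
    choose z hz using hb'
    let incl : (ℕ × ι) ⊕ A → (ℕ × ι) ⊕ N := Sum.map id fun z => ⟨z, hBN (hB.subset z.2)⟩
    have hr : ∀ s : ℕ → ι → 𝕄, (Sum.elim (uncurry s) Subtype.val) ∘ Sum.elim Sum.inr (incl ∘ z) =
        Sum.elim (fun n : N => (n : 𝕄)) (Sum.elim (uncurry s) Subtype.val ∘ z) := fun s => by
      funext t
      rcases t with t | t
      · rfl
      · simp only [comp_apply, Sum.elim_inr]
        rcases z t with p | p <;> rfl
    obtain ⟨f, hfm, hφ'⟩ := h (φ.relabel (Sum.elim Sum.inr (incl ∘ z))) (by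
      rw [Formula.realize_relabel, hr, show Sum.elim (uncurry a') Subtype.val ∘ z = b from funext hz]
      exact hφ)
    rw [Formula.realize_relabel, hr] at hφ'
    have htp : tp L A (uncurry a') = tp L A (uncurry (a ∘ f)) := tp_eq_of_imp fun ψ hψ => by
      obtain ⟨g, hg, hψ'⟩ := h (ψ.relabel incl) (by
        rw [Formula.realize_relabel, Sum.elim_comp_map]; exact hψ)
      rw [Formula.realize_relabel, Sum.elim_comp_map] at hψ'
      exact (realize_iff_of_tp_eq ((hB.indisc.mono hB.subset).tp_eq hg hfm) ψ fun j => j.2).1 hψ'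
    obtain ⟨ρ, hρ, e⟩ := h𝕄.exists_aut hA (h𝕄.prod_lt hι') htp
    have hb'' : Sum.elim (uncurry (a ∘ f)) Subtype.val ∘ z = ρ ∘ b := by
      funext j
      simp only [comp_apply, ← hz j]
      rcases z j with p | p
      · exact (congrFun e p).symm
      · exact (hρ p p.2).symm
    rw [hb''] at hφ'
    refine indep_iff_not_forks.1 hNi m φ (ρ ∘ b) (fun j => ?_) hφ' ?_
    · rw [← hb'', comp_apply]
      rcases z j with p | p
      · exact Or.inr (mem_entries (Set.mem_univ _) _)
      · exact Or.inl p.2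
    · have := hf.image_aut ρ
      rwa [image_eq_of_fixes hρ] at this
  -- this sequence is conjugate to `a` over `B`
  have htp : tp L B (uncurry a') = tp L B (uncurry a) := tp_eq_of_imp fun ψ hψ => by
    obtain ⟨g, hg, hψ'⟩ := h (ψ.relabel (Sum.map id fun z : B => ⟨z, hBN z.2⟩)) (by
      rw [Formula.realize_relabel, Sum.elim_comp_map]; exact hψ)
    rw [Formula.realize_relabel, Sum.elim_comp_map] at hψ'
    exact (realize_iff_of_tp_eq (hB.indisc.tp_eq hg strictMono_id) ψ fun j => j.2).1 hψ'
  obtain ⟨σ, hσ, e⟩ := h𝕄.exists_aut hBκ (h𝕄.prod_lt hι') htp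
  have e' : ∀ l, σ ∘ a' l = a l := fun l => funext fun j => congrFun e (l, j)
  refine ⟨σ '' N, fun z hz => ⟨z, hBN hz, hσ z hz⟩, meetsDefinable_image_aut hNd σ, ?_, ?_, ?_, ?_⟩
  · exact fun z hz => ⟨z, hBN (hB.subset hz), hσ z (hB.subset hz)⟩
  · exact Cardinal.mk_image_le.trans hN
  · have := hNi'.image_aut σ
    rwa [image_eq_of_fixes fun z hz => hσ z (hB.subset hz), image_entries (f := id) e',
      Set.range_id] at this
  · have := ha'.image_aut σ
    simpa only [e'] using this

theorem IsIndepBase.exists_isCoheirSequence (h𝕄 : IsMonster T 𝕄 κ) (hex : ExistenceAxiom L 𝕄 κ)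
    (hμ : ℵ₀ ≤ μ) (hμκ : μ < κ) (hL : Cardinal.lift.{w} L.card ≤ Cardinal.lift.{max u v} μ)
    (hι : Cardinal.lift.{w} #ι ≤ Cardinal.lift.{x} μ) (ha : IsMorley L A a)
    (hB : IsIndepBase L A a μ B) :
    ∃ M : L.ElementarySubstructure 𝕄, B ⊆ M ∧ IsIndepBase L A a μ (M : Set 𝕄) ∧
      (∀ k : ℕ, IsHeirOver L (M : Set 𝕄) (fun z : {i : ℕ // i < k} × ι => a z.1 z.2)
        (fun z : {i : ℕ // k ≤ i} × ι => a z.1 z.2)) ∧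
      IsCoheirSequence L (M : Set 𝕄) a := by
  have step : ∀ C : {C // IsIndepBase L A a μ C}, ∃ (J : ℕ → ι → 𝕄)
      (C' : {C // IsIndepBase L A a μ C}), IsContinuation L C.1 a J ∧
        C.1 ∪ entries J Set.univ ⊆ C'.1 ∧ L.MeetsDefinable C'.1 := by
    rintro ⟨C, hC⟩
    obtain ⟨J, hJ⟩ := h𝕄.exists_isContinuation hμ hμκ hι (hC.card_le.trans_lt hμκ) hC.indisc
    obtain ⟨C', h1, h2, h3⟩ := (hC.union_continuation h𝕄 hμ hμκ hι ha hJ).exists_model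
      h𝕄 hex hμ hμκ hL hι
    exact ⟨J, ⟨C', h3⟩, hJ, h1, h2⟩
  choose J₀ next hJ₀ hnext hdef using step
  let C : ℕ → {C // IsIndepBase L A a μ C} := fun n => Nat.rec ⟨B, hB⟩ (fun _ C => next C) n
  let J : ℕ → ℕ → ι → 𝕄 := fun n => J₀ (C n)
  have hJ : ∀ n, IsContinuation L (C n).1 a (J n) := fun n => hJ₀ _
  have hmono : Monotone fun n => (C n).1 := monotone_nat_of_le_succ fun n =>
    Set.subset_union_left.trans (hnext (C n))
  let N : Set 𝕄 := ⋃ n, (C n).1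
  have hJN : ∀ n l j, J n l j ∈ N := fun n l j =>
    Set.mem_iUnion.2 ⟨n + 1, hnext (C n) (Or.inr (mem_entries (Set.mem_univ _) j))⟩
  have hN : L.MeetsDefinable N := meetsDefinable_iUnion hmono fun n => hdef (C n)
  obtain ⟨M, hM⟩ : ∃ M : L.ElementarySubstructure 𝕄, (M : Set 𝕄) = N :=
    ⟨hN.toElementarySubstructure, hN.closure_eq_self⟩
  refine ⟨M, ?_⟩
  rw [hM]
  refine ⟨Set.subset_iUnion (fun n => (C n).1) 0, ⟨?_, ?_, ?_, fun n i j hi hj => ?_⟩,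
    fun k => ?_, ?_⟩
  · exact hB.subset.trans (Set.subset_iUnion (fun n => (C n).1) 0)
  · have := Cardinal.mk_iUnion_le_lift fun n => (C n).1
    simp only [Cardinal.lift_uzero, Cardinal.mk_nat, Cardinal.lift_aleph0] at this
    exact this.trans (Cardinal.mul_le_of_le hμ hμ (ciSup_le' fun n => (C n).2.card_le))
  · exact setIndep_iUnion_left hmono fun n => (C n).2.indep
  · refine tp_eq_iff.2 fun m φ b hb => ?_
    obtain ⟨n', hn'⟩ := exists_forall_mem_union hmono (E := ∅) fun t => Or.inl (hb t)
    exact tp_eq_iff.1 ((C n').2.indisc n i j hi hj) m φ b fun t =>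
      (hn' n' le_rfl t).resolve_right id
  · intro θ hθ
    rw [contains_tp] at hθ
    obtain ⟨m, φ, b, e⟩ := exists_fin_inst (𝕄 := 𝕄) θ
    obtain ⟨n, hn⟩ := exists_forall_mem_union hmono fun j => (b j).2
    obtain ⟨σ, hσ, eσ⟩ := hJ n k
    refine ⟨fun z => J n (z.1 - k) z.2, fun z => hJN _ _ _, (e _).2 ?_⟩
    rw [e] at hθ
    rw [← realize_aut_sum_elim σ]
    convert hθ using 2
    · funext z
      have := congrFun (eσ (z.1 - k)) z.2
      rwa [Nat.add_sub_cancel' z.1.2] at this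
    · funext j
      refine hσ _ ((hn n le_rfl j).imp id ?_)
      rintro ⟨z, hz⟩
      rw [show (fun j => (b j : 𝕄)) j = a z.1 z.2 from hz.symm]
      exact mem_entries (Set.mem_Iio.2 z.1.2) z.2
  · -- the coheir is the limit of the types of the first terms of the continuations
    have hq : ∀ {m : ℕ} (φ : L.Formula (ι ⊕ Fin m)) (b : Fin m → 𝕄),
        GlobalContains (limType L Set.univ (hyperfilter ℕ) fun n => J n 0) φ b ↔
          ∀ᶠ n in (hyperfilter ℕ : Filter ℕ), φ.Realize (Sum.elim (J n 0) b) := fun φ b => by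
      unfold GlobalContains
      rw [contains_limType]
      simp only [realize_inst]
    refine ⟨limType L Set.univ (hyperfilter ℕ) fun n => J n 0, fun m φ b b' hbb' => ?_,
      fun θ hθ => ?_, fun i m φ b hb hφ => ?_⟩
    · rw [hq, hq]
      refine eventually_congr (Eventually.of_forall fun n => ?_)
      have := realize_iff_of_tp_eq hbb' (φ.relabel Sum.swap) (c := J n 0) fun j => hJN _ _ _
      simpa only [Formula.realize_relabel, Sum.elim_swap] using this
    · rw [contains_limType] at hθ
      obtain ⟨n, hn⟩ := hθ.exists
      exact ⟨J n 0, fun j => hJN _ _ _, hn⟩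
    · rw [hq] at hφ
      obtain ⟨n₀, hn₀⟩ := exists_forall_mem_union hmono hb
      obtain ⟨n, hφ, hn⟩ :=
        (hφ.and (Nat.hyperfilter_le_atTop (eventually_ge_atTop n₀))).exists
      obtain ⟨σ, hσ, eσ⟩ := hJ n i
      rw [← realize_aut_sum_elim σ, eσ, show σ ∘ b = b from
        funext fun j => hσ _ (hn₀ n hn j)] at hφ
      exact hφ

end Construction
end MonsterModel

theorem mainTheorem9 {L : FirstOrder.Language.{u, v}} (T : L.Theory)
    (hT : T.IsComplete) (𝕄 : Type w) [L.Structure 𝕄] [Nonempty 𝕄] (κ : Cardinal.{w})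
    (h𝕄 : MonsterModel.IsMonster T 𝕄 κ)
    (hex : MonsterModel.ExistenceAxiom L 𝕄 κ)
    (A : Set 𝕄) (hA : #A < κ)
    {ι : Type x} (hι : Cardinal.lift.{w} #ι < Cardinal.lift.{x} κ)
    (a : ℕ → ι → 𝕄) (ha : MonsterModel.IsMorley L A a) :
    (∃ M : L.ElementarySubstructure 𝕄, #M < κ ∧ A ⊆ (M : Set 𝕄) ∧
      MonsterModel.Indep L A (fun m : M => (m : 𝕄)) (MonsterModel.entries a Set.univ) ∧
      MonsterModel.Indiscernible L (M : Set 𝕄) a ∧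
      (∀ k : ℕ, MonsterModel.IsHeirOver L (M : Set 𝕄)
        (fun z : {i : ℕ // i < k} × ι => a z.1 z.2)
        (fun z : {i : ℕ // k ≤ i} × ι => a z.1 z.2)) ∧
      MonsterModel.IsCoheirSequence L (M : Set 𝕄) a) ∧
    (∀ M₀ : L.ElementarySubstructure 𝕄, #M₀ < κ → A ⊆ (M₀ : Set 𝕄) →
      MonsterModel.Indep L A (fun m : M₀ => (m : 𝕄)) (MonsterModel.entries a Set.univ) →
      MonsterModel.Indiscernible L (M₀ : Set 𝕄) a →
      ∃ M : L.ElementarySubstructure 𝕄, #M < κ ∧ (M₀ : Set 𝕄) ⊆ (M : Set 𝕄) ∧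
        MonsterModel.Indep L A (fun m : M => (m : 𝕄)) (MonsterModel.entries a Set.univ) ∧
        MonsterModel.IsCoheirSequence L (M : Set 𝕄) a) := by
  -- `κ` may be singular, so the sizes of all sets are kept below a fixed `μ < κ`
  have key : ∀ B : Set 𝕄, #B < κ → ∃ μ < κ, ℵ₀ ≤ μ ∧ #B ≤ μ ∧
      Cardinal.lift.{w} L.card ≤ Cardinal.lift.{max u v} μ ∧
      Cardinal.lift.{w} #ι ≤ Cardinal.lift.{x} μ := by
    intro B hB
    obtain ⟨c, hc⟩ := Cardinal.mem_range_lift_of_le h𝕄.card_language_lt.le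
    obtain ⟨d, hd⟩ := Cardinal.mem_range_lift_of_le hι.le
    have hcκ : c < κ := Cardinal.lift_lt.1 (hc ▸ h𝕄.card_language_lt)
    have hdκ : d < κ := Cardinal.lift_lt.1 (hd ▸ hι)
    refine ⟨max (max ℵ₀ #B) (max c d), max_lt (max_lt h𝕄.aleph0_lt hB) (max_lt hcκ hdκ),
      le_max_of_le_left (le_max_left _ _), le_max_of_le_left (le_max_right _ _), ?_, ?_⟩
    · rw [← hc]
      exact Cardinal.lift_le.2 (le_max_of_le_right (le_max_left _ _))
    · rw [← hd]
      exact Cardinal.lift_le.2 (le_max_of_le_right (le_max_right _ _))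
  constructor
  · obtain ⟨μ, hμκ, hμ, hAμ, hL, hιμ⟩ := key A hA
    have hIκ : #(MonsterModel.entries a Set.univ) < κ :=
      (MonsterModel.mk_entries_le hμ hιμ a _).trans_lt hμκ
    have hAI : MonsterModel.SetIndep L A A (MonsterModel.entries a Set.univ) := by
      obtain ⟨σ, hσ, h⟩ := h𝕄.exists_aut_setIndep hA hA (by simpa using h𝕄.aleph0_lt.pos) hIκ
        (Set.empty_subset _) (hex.setIndep hA A)
      rwa [MonsterModel.image_eq_of_fixes fun z hz => hσ z (Or.inl hz)] at h
    have hind : MonsterModel.Indiscernible L A a := by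
      obtain ⟨p, h, -⟩ := ha
      exact h
    obtain ⟨M, hAM, hM, hheir, hcoheir⟩ := MonsterModel.IsIndepBase.exists_isCoheirSequence
      h𝕄 hex hμ hμκ hL hιμ ha ⟨subset_rfl, hAμ, hAI, hind⟩
    exact ⟨M, hM.card_le.trans_lt hμκ, hAM, hM.indep, hM.indisc, hheir, hcoheir⟩
  · intro M₀ hM₀ hAM₀ hindep hind
    obtain ⟨μ, hμκ, hμ, hM₀μ, hL, hιμ⟩ := key M₀ hM₀
    obtain ⟨M, hM₀M, hM, -, hcoheir⟩ := MonsterModel.IsIndepBase.exists_isCoheirSequence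
      h𝕄 hex hμ hμκ hL hιμ ha ⟨hAM₀, hM₀μ, hindep, hind⟩
    exact ⟨M, hM.card_le.trans_lt hμκ, hM₀M, hM.indep, hcoheir⟩
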